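/- **Theorem 3.1.** Let $T>0$ and let $a,b,c,d:[0,\infty)\to\mathbb H$ be continuous, $T$-periodic quaternion-valued functions, $a=a_0+ia_1+ja_2+ka_3$ with real $a_n$, and similarly for $b,c,d$. Consider the Riccati equation $$q'+q\,a(t)\,q+b(t)\,q+q\,c(t)+d(t)=0,\qquad t\ge 0. \tag{R}$$ Put $p_{0,m}=b_m+c_m$ for $m=1,2,3$, and $p_{1,1}=b_1+c_1$, $p_{1,2}=b_2-c_2$, $p_{1,3}=b_3-c_3$, and let $$D_0(t)=\begin{cases}\sum_{m=1}^3p_{0,m}^2(t)+4a_0(t)d_0(t), & a_0(t)\neq0,\\ 4d_0(t), & a_0(t)=0,\end{cases}\qquad D_1(t)=\begin{cases}\sum_{m=1}^3p_{1,m}^2(t)-4a_1(t)d_1(t), & a_1(t)\neq0,\\ -4d_1(t), & a_1(t)=0.\end{cases}$$ For real functions $u,v$ on $[0,\infty)$ let $[u/v]_0(t)=u(t)/v(t)$ if $v(t)\ne0$ and $[u/v]_0(t)=0$ if $v(t)=0$; let $\operatorname{supp}u$ be the closure of $\{t\ge0:u(t)\neq0\}$. Assume, for $t\ge0$: 1.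 $a_0(t)\ge0$, $a_1(t)\ge0$, $a_0+a_1\not\equiv0$, and $a_2=a_3\equiv0$; 2. $D_n(t)\le0$ and $D_n\not\equiv0$ for $n=0,1$; 3. $\operatorname{supp}p_{n,m}\subset\operatorname{supp}a_n$ for $n=0,1$ and $m=1,2,3$; 4. $\bigl[\tfrac{b_n+c_n}{a_0}\bigr]_0$ and $\bigl[\tfrac{b_n-c_n}{a_1}\bigr]_0$, $n=2,3$, are bounded on $[0,\infty)$; 5. $\int_0^T\bigl(b_0(\tau)+c_0(\tau)\bigr)\,d\tau\ge0$. Then there are a natural number $m_0\ge1$ and an $m_0T$-periodic solution $q=q_0-iq_1-jq_2-kq_3$ of (R) on $[0,\infty)$ with $q_0(t)\ge0$ and $q_1(t)\ge0$ for all $t\ge0$. If in addition $D_0D_1\not\equiv0$, then every solution $\tilde q=\tilde q_0-i\tilde q_1-j\tilde q_2-k\tilde q_3$ of (R) with $\tilde q_0(0)\ge0$ and $\tilde q_1(0)\ge0$ (in particular $q$) exists on $[0,\infty)$ and is $0$-normal, and the function $t\mapsto\int_0^t\operatorname{Re}\bigl[a(\tau)\bigl(q(\tau)-\tilde q(\tau)\bigr)\bigr]\,d\tau$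 is bounded on $[0,\infty)$. Here a solution $r$ of (R) on $[0,\infty)$ is called $t_1$-normal ($t_1\ge0$) if $r(t_1)$ has a neighbourhood $U$ such that every solution of (R) whose value at $t_1$ lies in $U$ exists on $[t_1,\infty)$. -/

import Mathlib

open scoped Quaternion Topology

namespace QRiccati

/-- `q` solves `q' + q a q + b q + q c + d = 0` on the interval `I`
(one-sided derivative at an end point that belongs to `I`). -/
def IsSolutionOn (a b c d : ℝ → ℍ[ℝ]) (I : Set ℝ) (q : ℝ → ℍ[ℝ]) : Prop :=
  ∀ t ∈ I, HasDerivWithinAt q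
    (-(q t * a t * q t + b t * q t + q t * c t + d t)) I t

/-- `f` is `T`-periodic on the half-line `[0, ∞)`. -/
def PeriodicOnHalfLine (T : ℝ) (f : ℝ → ℍ[ℝ]) : Prop :=
  ∀ t, 0 ≤ t → f (t + T) = f t

/-- The function `D₀`, with `p_{0,m} = b_m + c_m` for `m = 1, 2, 3`. -/
noncomputable def D₀ (a b c d : ℝ → ℍ[ℝ]) (t : ℝ) : ℝ :=
  if (a t).re ≠ 0 then
    ((b t).imI + (c t).imI) ^ 2 + ((b t).imJ + (c t).imJ) ^ 2 + ((b t).imK + (c t).imK) ^ 2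
      + 4 * (a t).re * (d t).re
  else 4 * (d t).re

/-- The function `D₁`, with `p_{1,1} = b₁ + c₁`, `p_{1,2} = b₂ - c₂`, `p_{1,3} = b₃ - c₃`. -/
noncomputable def D₁ (a b c d : ℝ → ℍ[ℝ]) (t : ℝ) : ℝ :=
  if (a t).imI ≠ 0 then
    ((b t).imI + (c t).imI) ^ 2 + ((b t).imJ - (c t).imJ) ^ 2 + ((b t).imK - (c t).imK) ^ 2
      - 4 * (a t).imI * (d t).imI
  else -4 * (d t).imI

/-- The (closed) support of a real function on the half-line `[0, ∞)`. -/
def supp (u : ℝ → ℝ) : Set ℝ := closure {t | 0 ≤ t ∧ u t ≠ 0}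

/-- The quotient `[u / v]₀`, equal to `0` where `v` vanishes. -/
noncomputable def quot₀ (u v : ℝ → ℝ) (t : ℝ) : ℝ :=
  if v t ≠ 0 then u t / v t else 0

/-- Boundedness of a real function on `[0, ∞)`. -/
def BoundedOnHalfLine (u : ℝ → ℝ) : Prop := ∃ M : ℝ, ∀ t, 0 ≤ t → |u t| ≤ M

/-- With `q = q₀ - i q₁ - j q₂ - k q₃`, the condition `q₀ ≥ 0` and `q₁ ≥ 0`. -/
def NonnegComponents (q : ℍ[ℝ]) : Prop := 0 ≤ q.re ∧ 0 ≤ -q.imI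

/-- `q` is a `t₁`-normal solution: it is a solution on `[0, ∞)`, and every solution which starts at
time `t₁` close enough to `q t₁`, and is defined on some `[t₁, τ)`, exists on all of `[t₁, ∞)`, that
is, is the restriction of a solution on `[t₁, ∞)`. -/
def IsNormal (a b c d : ℝ → ℍ[ℝ]) (t₁ : ℝ) (q : ℝ → ℍ[ℝ]) : Prop :=
  IsSolutionOn a b c d (Set.Ici 0) q ∧
    ∃ U ∈ 𝓝 (q t₁), ∀ τ : ℝ, t₁ < τ → ∀ r : ℝ → ℍ[ℝ],
      IsSolutionOn a b c d (Set.Ico t₁ τ) r → r t₁ ∈ U →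
        ∃ s : ℝ → ℍ[ℝ], IsSolutionOn a b c d (Set.Ici t₁) s ∧ Set.EqOn s r (Set.Ico t₁ τ)

/-- The integral of `Re [a (q - r)]` over `[0, t]`. -/
noncomputable def diffIntegral (a q r : ℝ → ℍ[ℝ]) (t : ℝ) : ℝ :=
  ∫ τ in (0 : ℝ)..t, (a τ * (q τ - r τ)).re

end QRiccati

open scoped Quaternion Topology

namespace QRiccati

open Set Filter

/-! The derivative of q₀ is a multiple of q₀ plus `inward₀`, a quadratic polynomial in the other
components. The discriminant conditions make it nonnegative, and the same happens for q₁ with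
`inward₁`. An integrating factor then shows that {q₀ ≥ 0, q₁ ≥ 0} is forward invariant; on this set
Re(aq) ≥ 0. Solutions are quotients Y X⁻¹ of a linear system, and inside the set X cannot vanish
(`IsLinearization.ne_zero`), which gives global existence.

Solutions in the set are bounded: as long as q is large, q⁻¹ is small and moves essentially with
velocity a, but a₀ + a₁ has a positive integral over a period, so q cannot stay large for a whole
period (`exists_norm_le_of_isSolutionOn_period`).

The quantity |q - r|²/(q₀ r₀) is a function of the hyperbolic distance in the half-space q₀ > 0. Its
logarithmic derivative is -a₀(q₀ + r₀) - inward₀(q)/q₀ - inward₀(r)/r₀, and since D₀ ≢ 0 this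
produces a fixed contraction factor per period (`halfSpaceDist_le_mul_exp`). So any two solutions in
the set approach each other exponentially (`exists_exp_decay`). Comparing a solution with its
translate by T makes the iterates of the period map Cauchy; the limit starts a T-periodic solution,
so m₀ = 1 works. The same decay bounds the integral of Re[a(q - q̃)].

For normality, D₀D₁ ≢ 0 pushes every solution of the set into its interior by some time t₁.
Continuous dependence for the linear system then brings nearby solutions into the set at t₁, even if
they start outside it (`QuadrantInvariant.isNormal`). -/

/-! ### Scalar differential inequalities. -/

/-- **Grönwall's inequality** with a variable coefficient. -/
theorem le_mul_exp_integral_of_deriv_le {f f' h : ℝ → ℝ} {s t : ℝ} (hst : s ≤ t)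
    (hh : ContinuousOn h (Icc s t))
    (hf : ∀ x ∈ Icc s t, HasDerivWithinAt f (f' x) (Icc s t) x)
    (hle : ∀ x ∈ Icc s t, f' x ≤ h x * f x) :
    f t ≤ f s * Real.exp (∫ x in s..t, h x) := by
  -- Extending `h` by constants beyond the interval makes its primitive differentiable on all of ℝ.
  set k : ℝ → ℝ := IccExtend hst ((Icc s t).domRestrict h) with hk
  have hkc : Continuous k := (continuousOn_iff_continuous_domRestrict.1 hh).Icc_extend'
  have hkh : ∀ x ∈ Icc s t, k x = h x := fun x hx => by
    rw [hk, IccExtend_of_mem hst _ hx]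
    rfl
  have hint : ∫ x in s..t, h x = ∫ x in s..t, k x :=
    intervalIntegral.integral_congr fun x hx => (hkh x (by rwa [uIcc_of_le hst] at hx)).symm
  have hH : ∀ x, HasDerivAt (fun x => ∫ y in s..x, k y) (k x) x := fun x =>
    intervalIntegral.integral_hasDerivAt_right (hkc.intervalIntegrable _ _)
      (hkc.stronglyMeasurableAtFilter _ _) hkc.continuousAt
  have hg : ∀ x ∈ Icc s t, HasDerivWithinAt (fun x => f x * Real.exp (-∫ y in s..x, k y))
      (f' x * Real.exp (-∫ y in s..x, k y)
        + f x * (Real.exp (-∫ y in s..x, k y) * (-k x))) (Icc s t) x := fun x hx =>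
    (hf x hx).mul (hH x).neg.exp.hasDerivWithinAt
  have hanti : AntitoneOn (fun x => f x * Real.exp (-∫ y in s..x, k y)) (Icc s t) := by
    refine antitoneOn_of_hasDerivWithinAt_nonpos (convex_Icc s t)
      (fun x hx => (hg x hx).continuousWithinAt)
      (fun x hx => (hg x (interior_subset hx)).mono interior_subset) fun x hx => ?_
    have h1 := hle x (interior_subset hx)
    rw [← hkh x (interior_subset hx)] at h1
    have := Real.exp_pos (-∫ y in s..x, k y)
    nlinarith
  have := hanti (left_mem_Icc.2 hst) (right_mem_Icc.2 hst) hst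
  simp only [intervalIntegral.integral_same, neg_zero, Real.exp_zero, mul_one] at this
  rw [hint]
  calc f t = f t * Real.exp (-∫ y in s..t, k y) * Real.exp (∫ y in s..t, k y) := by
        rw [mul_assoc, ← Real.exp_add]; simp
    _ ≤ _ := by gcongr

theorem mul_exp_integral_le_of_le_deriv {f f' h : ℝ → ℝ} {s t : ℝ} (hst : s ≤ t)
    (hh : ContinuousOn h (Icc s t))
    (hf : ∀ x ∈ Icc s t, HasDerivWithinAt f (f' x) (Icc s t) x)
    (hle : ∀ x ∈ Icc s t, h x * f x ≤ f' x) :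
    f s * Real.exp (∫ x in s..t, h x) ≤ f t := by
  have := le_mul_exp_integral_of_deriv_le (f := fun x => -f x) (f' := fun x => -f' x) hst hh
    (fun x hx => (hf x hx).neg) (fun x hx => by have := hle x hx; linarith)
  linarith

/-! ### Global forward solutions of linear equations. -/

section LinearODE

variable {E : Type*} [NormedAddCommGroup E] [NormedSpace ℝ E]

/-- On the ball of radius ‖x‖ about x the field is at most 2M‖x‖, so Picard–Lindelöf needs only 2Mh
≤ 1. The step length does not depend on x, which is what allows steps to be chained indefinitely. -/
theorem exists_linearODE_solution_step [CompleteSpace E] {A : ℝ → E →L[ℝ] E} {M h : ℝ}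
    (hM : 0 < M)
    (hA : Continuous A) (hAM : ∀ t, ‖A t‖ ≤ M) (hh : 0 ≤ h) (hMh : M * h ≤ 1 / 2) (s : ℝ) (x : E) :
    ∃ f : ℝ → E, f s = x ∧
      ∀ t ∈ Icc s (s + h), HasDerivWithinAt f (A t (f t)) (Icc s (s + h)) t := by
  have hs : s ∈ Icc s (s + h) := ⟨le_rfl, by linarith⟩
  let r : NNReal := ⟨‖x‖, norm_nonneg x⟩
  let m : NNReal := ⟨M, hM.le⟩
  have hpl : IsPicardLindelof (fun t y => A t y) (⟨s, hs⟩ : Icc s (s + h)) x r 0 (2 * m * r) m :=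
    { lipschitzOnWith := fun t _ =>
        ((A t).lipschitz.weaken (show ‖A t‖₊ ≤ m from hAM t)).lipschitzOnWith
      continuousOn := fun y _ => (hA.clm_apply continuous_const).continuousOn
      norm_le := fun t _ y hy => by
        have h1 : ‖y‖ ≤ 2 * ‖x‖ := by
          have h2 : ‖y - x‖ ≤ ‖x‖ := by rw [← dist_eq_norm]; exact hy
          have := norm_le_insert' y x
          linarith
        calc ‖A t y‖ ≤ M * (2 * ‖x‖) := (A t).le_of_opNorm_le_of_le (hAM t) h1
          _ = 2 * M * ‖x‖ := by ring
      mul_max_le := by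
        have h0 : max (s + h - s) (s - s) = h := by simp [hh]
        change 2 * M * ‖x‖ * max (s + h - s) (s - s) ≤ ‖x‖ - 0
        rw [h0]
        nlinarith [norm_nonneg x] }
  exact hpl.exists_eq_forall_mem_Icc_hasDerivWithinAt₀

/-- A linear differential equation with bounded continuous coefficients has global forward
solutions. -/
theorem exists_linearODE_solution [CompleteSpace E] {A : ℝ → E →L[ℝ] E} {M : ℝ}
    (hA : Continuous A) (hAM : ∀ t, ‖A t‖ ≤ M) (x : E) :
    ∃ f : ℝ → E, f 0 = x ∧ ∀ t ∈ Ici (0 : ℝ), HasDerivWithinAt f (A t (f t)) (Ici 0) t := by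
  have hM0 : 0 ≤ M := (norm_nonneg _).trans (hAM 0)
  set N : ℝ := M + 1
  have hN : 0 < N := by positivity
  set h : ℝ := 1 / (2 * N)
  have hh : 0 < h := by positivity
  have hNh : N * h ≤ 1 / 2 := by simp only [h]; field_simp; norm_num
  choose F hF0 hF using exists_linearODE_solution_step hN hA
    (fun t => (hAM t).trans (by simp [N])) hh.le hNh
  let X : ℕ → E := fun n => Nat.rec x (fun n y => F (n * h) y (n * h + h)) n
  have hX : ∀ n : ℕ, X (n + 1) = F (n * h) (X n) (n * h + h) := fun n => rfl
  let f : ℝ → E := fun t => F (⌊t / h⌋₊ * h) (X ⌊t / h⌋₊) t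
  -- The right end point of a cell is included: there the floor already selects the next cell, whose
  -- initial value was chosen to agree.
  have hcell : ∀ n : ℕ, ∀ t ∈ Icc (n * h) (n * h + h), f t = F (n * h) (X n) t := by
    intro n t ht
    rcases ht.2.eq_or_lt with h1 | h1
    · have : ⌊t / h⌋₊ = n + 1 := by
        rw [h1, show (n * h + h) / h = ((n + 1 : ℕ) : ℝ) by push_cast; field_simp,
          Nat.floor_natCast]
      simp only [f, this]
      have e : ((n + 1 : ℕ) : ℝ) * h = t := by rw [h1]; push_cast; ring
      rw [e, hF0, hX, ← h1]
    · have : ⌊t / h⌋₊ = n := by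
        rw [Nat.floor_eq_iff (div_nonneg (le_trans (by positivity) ht.1) hh.le)]
        rw [le_div_iff₀ hh, div_lt_iff₀ hh]
        exact ⟨ht.1, by linarith⟩
      simp only [f, this]
  have hder : ∀ n : ℕ, ∀ t ∈ Icc (n * h) (n * h + h),
      HasDerivWithinAt f (A t (f t)) (Icc (n * h) (n * h + h)) t := by
    intro n t ht
    have := hF (n * h) (X n) t ht
    rw [← hcell n t ht] at this
    exact this.congr (hcell n) (hcell n t ht)
  refine ⟨f, ?_, fun t ht => ?_⟩
  · have := hcell 0 0 (by simp [hh.le])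
    have e := hF0 ((0 : ℕ) * h) x
    rw [show ((0 : ℕ) : ℝ) * h = 0 by simp] at this e
    exact this.trans e
  · set n := ⌊t / h⌋₊
    have ht0 : (0 : ℝ) ≤ t := ht
    have h1 : n * h ≤ t := (le_div_iff₀ hh).1 (Nat.floor_le (div_nonneg ht hh.le))
    have h2 : t < n * h + h := by
      have := (div_lt_iff₀ hh).1 (Nat.lt_floor_add_one (t / h))
      linarith
    have hr := hder n t ⟨h1, h2.le⟩
    rcases h1.eq_or_lt with h1 | h1
    · have hr' : HasDerivWithinAt f (A t (f t)) (Ici t) t := by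
        exact hr.mono_of_mem_nhdsWithin (Icc_mem_nhdsGE_of_mem ⟨h1.le, h2⟩)
      rcases Nat.eq_zero_or_pos n with hn | hn
      · have : t = 0 := by rw [← h1, hn]; simp
        rwa [this] at hr' ⊢
      · obtain ⟨k, hk⟩ : ∃ k, n = k + 1 := ⟨n - 1, by omega⟩
        have e : (k : ℝ) * h + h = t := by rw [← h1, hk]; push_cast; ring
        have hl := hder k t ⟨by linarith, e.ge⟩
        have hl' : HasDerivWithinAt f (A t (f t)) (Iic t) t := by
          refine hl.mono_of_mem_nhdsWithin ?_
          rw [e]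
          exact Icc_mem_nhdsLE (by linarith)
        have := hl'.union hr'
        rw [Iic_union_Ici] at this
        exact this.mono (subset_univ _)
    · exact (hr.hasDerivAt (Icc_mem_nhds h1 h2)).hasDerivWithinAt

end LinearODE

/-! ### Components, norm and inverse of quaternion-valued functions. -/

section Components

variable {q : ℝ → ℍ[ℝ]} {q' : ℍ[ℝ]} {I : Set ℝ} {t : ℝ}

theorem norm_sq_eq_components (x : ℍ[ℝ]) :
    ‖x‖ ^ 2 = x.re ^ 2 + x.imI ^ 2 + x.imJ ^ 2 + x.imK ^ 2 := by
  rw [sq, ← Quaternion.normSq_eq_norm_mul_self, Quaternion.normSq_def']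

theorem abs_re_le_norm (x : ℍ[ℝ]) : |x.re| ≤ ‖x‖ :=
  abs_le_of_sq_le_sq (by
    rw [norm_sq_eq_components]
    linarith [sq_nonneg x.imI, sq_nonneg x.imJ, sq_nonneg x.imK]) (norm_nonneg _)

theorem abs_imI_le_norm (x : ℍ[ℝ]) : |x.imI| ≤ ‖x‖ :=
  abs_le_of_sq_le_sq (by
    rw [norm_sq_eq_components]
    linarith [sq_nonneg x.re, sq_nonneg x.imJ, sq_nonneg x.imK]) (norm_nonneg _)

theorem hasDerivWithinAt_re (h : HasDerivWithinAt q q' I t) :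
    HasDerivWithinAt (fun t => (q t).re) q'.re I t :=
  (LinearMap.toContinuousLinearMap
    (show ℍ[ℝ] →ₗ[ℝ] ℝ from QuaternionAlgebra.reₗ _ _ _)).hasFDerivAt.comp_hasDerivWithinAt t h

theorem hasDerivWithinAt_imI (h : HasDerivWithinAt q q' I t) :
    HasDerivWithinAt (fun t => (q t).imI) q'.imI I t :=
  (LinearMap.toContinuousLinearMap
    (show ℍ[ℝ] →ₗ[ℝ] ℝ from QuaternionAlgebra.imIₗ _ _ _)).hasFDerivAt.comp_hasDerivWithinAt t h

theorem hasDerivWithinAt_norm_sq (h : HasDerivWithinAt q q' I t) :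
    HasDerivWithinAt (fun t => ‖q t‖ ^ 2)
      (2 * ((q t).re * q'.re + (q t).imI * q'.imI + (q t).imJ * q'.imJ + (q t).imK * q'.imK)) I t := by
  convert h.norm_sq using 1
  rw [Quaternion.inner_def]
  simp

theorem hasDerivWithinAt_inv (h : HasDerivWithinAt q q' I t) (h0 : q t ≠ 0) :
    HasDerivWithinAt (fun t => (q t)⁻¹) (-((q t)⁻¹ * q' * (q t)⁻¹)) I t := by
  have := (hasFDerivAt_inv' (𝕜 := ℝ) h0).comp_hasDerivWithinAt t h
  simpa using! this

end Components

/-! ### Algebra of the right-hand side. -/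

/-- The part of the derivative of `q₀` that survives at `q₀ = 0`. -/
def inward₀ (a b c d q : ℍ[ℝ]) : ℝ :=
  a.re * (q.imI ^ 2 + q.imJ ^ 2 + q.imK ^ 2) + (b.imI + c.imI) * q.imI
    + (b.imJ + c.imJ) * q.imJ + (b.imK + c.imK) * q.imK - d.re

/-- The part of the derivative of `q₁` that survives at `q₁ = 0`. -/
def inward₁ (a b c d q : ℍ[ℝ]) : ℝ :=
  a.imI * (q.re ^ 2 + q.imJ ^ 2 + q.imK ^ 2) + (b.imI + c.imI) * q.re
    + (b.imJ - c.imJ) * q.imK - (b.imK - c.imK) * q.imJ + d.imI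

section Algebra

variable {a b c d q r : ℍ[ℝ]}

/-- Since a has no j and k parts, every term containing q₀ has q₀ as a factor; the remainder
`inward₀` does not involve q₀. This makes the equation for q₀ a scalar linear one with a forcing
term of known sign. -/
theorem rhs_re (hJ : a.imJ = 0) (hK : a.imK = 0) :
    (-(q * a * q + b * q + q * c + d)).re
      = -(a.re * q.re - 2 * a.imI * q.imI + (b.re + c.re)) * q.re + inward₀ a b c d q := by
  simp [inward₀, hJ, hK]
  ring

theorem rhs_imI (hJ : a.imJ = 0) (hK : a.imK = 0) :
    -(-(q * a * q + b * q + q * c + d)).imI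
      = -(2 * a.re * q.re - a.imI * q.imI + (b.re + c.re)) * (-q.imI) + inward₁ a b c d q := by
  simp [inward₁, hJ, hK]
  ring

/-- With x = q - r one has qaq - rar = x(aq) + (ra)x, and the inner product of x with xz or zx is
Re(z)|x|². Hence |q - r|² obeys an exact scalar linear equation, in which d no longer appears. -/
theorem inner_rhs_sub :
    2 * ((q - r).re * (-(q * a * q + b * q + q * c + d) - -(r * a * r + b * r + r * c + d)).re
      + (q - r).imI * (-(q * a * q + b * q + q * c + d) - -(r * a * r + b * r + r * c + d)).imI
      + (q - r).imJ * (-(q * a * q + b * q + q * c + d) - -(r * a * r + b * r + r * c + d)).imJ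
      + (q - r).imK * (-(q * a * q + b * q + q * c + d) - -(r * a * r + b * r + r * c + d)).imK)
    = -2 * ((a * q).re + (a * r).re + (b.re + c.re)) * ‖q - r‖ ^ 2 := by
  rw [norm_sq_eq_components]
  simp
  ring

theorem inner_rhs :
    2 * (q.re * (-(q * a * q + b * q + q * c + d)).re
      + q.imI * (-(q * a * q + b * q + q * c + d)).imI
      + q.imJ * (-(q * a * q + b * q + q * c + d)).imJ
      + q.imK * (-(q * a * q + b * q + q * c + d)).imK)
    = -2 * ((a * q).re + (b.re + c.re)) * ‖q‖ ^ 2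
      - 2 * (q.re * d.re + q.imI * d.imI + q.imJ * d.imJ + q.imK * d.imK) := by
  rw [norm_sq_eq_components]
  simp
  ring

/-- A quadratic polynomial in three variables with nonpositive discriminant. -/
theorem quadratic_nonneg_of_discrim_nonpos {α δ p₁ p₂ p₃ x₁ x₂ x₃ : ℝ} (hα : 0 ≤ α) (hδ : δ ≤ 0)
    (h : p₁ ^ 2 + p₂ ^ 2 + p₃ ^ 2 + 4 * α * δ ≤ 0) :
    0 ≤ 4 * α * (α * (x₁ ^ 2 + x₂ ^ 2 + x₃ ^ 2) + p₁ * x₁ + p₂ * x₂ + p₃ * x₃ - δ)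
        + (p₁ ^ 2 + p₂ ^ 2 + p₃ ^ 2 + 4 * α * δ) ∧
      0 ≤ α * (x₁ ^ 2 + x₂ ^ 2 + x₃ ^ 2) + p₁ * x₁ + p₂ * x₂ + p₃ * x₃ - δ := by
  have h1 : 0 ≤ 4 * α * (α * (x₁ ^ 2 + x₂ ^ 2 + x₃ ^ 2) + p₁ * x₁ + p₂ * x₂ + p₃ * x₃ - δ)
        + (p₁ ^ 2 + p₂ ^ 2 + p₃ ^ 2 + 4 * α * δ) := by
    -- Completing the squares: the left side is the sum of the (2αxᵢ + pᵢ)².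
    linarith [sq_nonneg (2 * α * x₁ + p₁), sq_nonneg (2 * α * x₂ + p₂),
      sq_nonneg (2 * α * x₃ + p₃)]
  refine ⟨h1, ?_⟩
  rcases hα.eq_or_lt with h0 | h0
  · rw [← h0] at h ⊢
    have e1 : p₁ = 0 := by nlinarith [sq_nonneg p₁, sq_nonneg p₂, sq_nonneg p₃]
    have e2 : p₂ = 0 := by nlinarith [sq_nonneg p₁, sq_nonneg p₂, sq_nonneg p₃]
    have e3 : p₃ = 0 := by nlinarith [sq_nonneg p₁, sq_nonneg p₂, sq_nonneg p₃]
    rw [e1, e2, e3]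
    linarith
  · by_contra! hn
    have := mul_neg_of_pos_of_neg (by linarith : 0 < 4 * α) hn
    linarith

theorem re_mul_nonneg (hJ : a.imJ = 0) (hK : a.imK = 0) (h0 : 0 ≤ a.re) (h1 : 0 ≤ a.imI)
    (hq : NonnegComponents q) : 0 ≤ (a * q).re := by
  have e : (a * q).re = a.re * q.re + a.imI * (-q.imI) := by
    simp [hJ, hK]
    ring
  rw [e]
  exact add_nonneg (mul_nonneg h0 hq.1) (mul_nonneg h1 hq.2)

end Algebra

/-! ### Forward invariance, uniqueness and continuous dependence. -/

/-- The properties of the coefficients that make `{q₀ ≥ 0, q₁ ≥ 0}` forward invariant. -/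
structure QuadrantInvariant (a b c d : ℝ → ℍ[ℝ]) : Prop where
  cont_a : ContinuousOn a (Ici 0)
  cont_b : ContinuousOn b (Ici 0)
  cont_c : ContinuousOn c (Ici 0)
  cont_d : ContinuousOn d (Ici 0)
  a_re : ∀ t, 0 ≤ t → 0 ≤ (a t).re
  a_imI : ∀ t, 0 ≤ t → 0 ≤ (a t).imI
  a_imJ : ∀ t, 0 ≤ t → (a t).imJ = 0
  a_imK : ∀ t, 0 ≤ t → (a t).imK = 0
  d_re : ∀ t, 0 ≤ t → (d t).re ≤ 0
  d_imI : ∀ t, 0 ≤ t → 0 ≤ (d t).imI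
  disc₀ : ∀ t, 0 ≤ t → ((b t).imI + (c t).imI) ^ 2 + ((b t).imJ + (c t).imJ) ^ 2
    + ((b t).imK + (c t).imK) ^ 2 + 4 * (a t).re * (d t).re ≤ 0
  disc₁ : ∀ t, 0 ≤ t → ((b t).imI + (c t).imI) ^ 2 + ((b t).imJ - (c t).imJ) ^ 2
    + ((b t).imK - (c t).imK) ^ 2 - 4 * (a t).imI * (d t).imI ≤ 0

theorem IsSolutionOn.mono {a b c d q : ℝ → ℍ[ℝ]} {I J : Set ℝ}
    (h : IsSolutionOn a b c d I q) (hJ : J ⊆ I) : IsSolutionOn a b c d J q :=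
  fun t ht => (h t (hJ ht)).mono hJ

theorem IsSolutionOn.continuousOn {a b c d q : ℝ → ℍ[ℝ]} {I : Set ℝ}
    (h : IsSolutionOn a b c d I q) : ContinuousOn q I :=
  fun t ht => (h t ht).continuousWithinAt

theorem Icc_subset_Ici_zero {s t : ℝ} (hs : 0 ≤ s) : Icc s t ⊆ Ici 0 :=
  fun _ hx => hs.trans hx.1

section Flow

variable {a b c d q r : ℝ → ℍ[ℝ]} {s t : ℝ}

theorem continuousOn_re {f : ℝ → ℍ[ℝ]} {I : Set ℝ} (h : ContinuousOn f I) :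
    ContinuousOn (fun t => (f t).re) I := Quaternion.continuous_re.comp_continuousOn h

theorem continuousOn_imI {f : ℝ → ℍ[ℝ]} {I : Set ℝ} (h : ContinuousOn f I) :
    ContinuousOn (fun t => (f t).imI) I := Quaternion.continuous_imI.comp_continuousOn h

theorem continuousOn_imJ {f : ℝ → ℍ[ℝ]} {I : Set ℝ} (h : ContinuousOn f I) :
    ContinuousOn (fun t => (f t).imJ) I := Quaternion.continuous_imJ.comp_continuousOn h

theorem continuousOn_imK {f : ℝ → ℍ[ℝ]} {I : Set ℝ} (h : ContinuousOn f I) :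
    ContinuousOn (fun t => (f t).imK) I := Quaternion.continuous_imK.comp_continuousOn h

theorem QuadrantInvariant.inward₀_nonneg (H : QuadrantInvariant a b c d) (ht : 0 ≤ t) (x : ℍ[ℝ]) :
    0 ≤ inward₀ (a t) (b t) (c t) (d t) x :=
  (quadratic_nonneg_of_discrim_nonpos (H.a_re t ht) (H.d_re t ht) (H.disc₀ t ht)).2

theorem QuadrantInvariant.inward₁_nonneg (H : QuadrantInvariant a b c d) (ht : 0 ≤ t) (x : ℍ[ℝ]) :
    0 ≤ inward₁ (a t) (b t) (c t) (d t) x := by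
  have := (quadratic_nonneg_of_discrim_nonpos (α := (a t).imI) (δ := -(d t).imI)
    (p₁ := (b t).imI + (c t).imI) (p₂ := (b t).imJ - (c t).imJ) (p₃ := (b t).imK - (c t).imK)
    (x₁ := x.re) (x₂ := x.imK) (x₃ := -x.imJ)
    (H.a_imI t ht) (by linarith [H.d_imI t ht]) (by linarith [H.disc₁ t ht])).2
  unfold inward₁
  linarith

/-- The integrating factor depends on the solution itself, but it is positive, and that alone
transports both `0 ≤` and `0 <` forward in time. -/
theorem QuadrantInvariant.exists_re_ge (H : QuadrantInvariant a b c d) (hs : 0 ≤ s) (hst : s ≤ t)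
    (hq : IsSolutionOn a b c d (Icc s t) q) : ∃ κ > 0, (q s).re * κ ≤ (q t).re := by
  have hI := Icc_subset_Ici_zero (t := t) hs
  have hqc := hq.continuousOn
  have hac := H.cont_a.mono hI
  refine ⟨_, Real.exp_pos _, mul_exp_integral_le_of_le_deriv
    (h := fun x => -((a x).re * (q x).re - 2 * (a x).imI * (q x).imI + ((b x).re + (c x).re)))
    hst ?_ (fun x hx => hasDerivWithinAt_re (hq x hx)) fun x hx => ?_⟩
  · exact ((((continuousOn_re hac).mul (continuousOn_re hqc)).sub
      (((continuousOn_imI hac).const_mul 2).mul (continuousOn_imI hqc))).add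
      ((continuousOn_re (H.cont_b.mono hI)).add (continuousOn_re (H.cont_c.mono hI)))).neg
  · rw [rhs_re (H.a_imJ x (hI hx)) (H.a_imK x (hI hx))]
    linarith [H.inward₀_nonneg (hI hx) (q x)]

theorem QuadrantInvariant.exists_neg_imI_ge (H : QuadrantInvariant a b c d) (hs : 0 ≤ s)
    (hst : s ≤ t) (hq : IsSolutionOn a b c d (Icc s t) q) :
    ∃ κ > 0, -(q s).imI * κ ≤ -(q t).imI := by
  have hI := Icc_subset_Ici_zero (t := t) hs
  have hqc := hq.continuousOn
  have hac := H.cont_a.mono hI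
  refine ⟨_, Real.exp_pos _, mul_exp_integral_le_of_le_deriv (f := fun x => -(q x).imI)
    (h := fun x => -(2 * (a x).re * (q x).re - (a x).imI * (q x).imI + ((b x).re + (c x).re)))
    hst ?_ (fun x hx => (hasDerivWithinAt_imI (hq x hx)).neg) fun x hx => ?_⟩
  · exact (((((continuousOn_re hac).const_mul 2).mul (continuousOn_re hqc)).sub
      ((continuousOn_imI hac).mul (continuousOn_imI hqc))).add
      ((continuousOn_re (H.cont_b.mono hI)).add (continuousOn_re (H.cont_c.mono hI)))).neg
  · rw [rhs_imI (H.a_imJ x (hI hx)) (H.a_imK x (hI hx))]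
    linarith [H.inward₁_nonneg (hI hx) (q x)]

theorem QuadrantInvariant.re_nonneg (H : QuadrantInvariant a b c d) (hs : 0 ≤ s) (hst : s ≤ t)
    (hq : IsSolutionOn a b c d (Icc s t) q) (h : 0 ≤ (q s).re) : 0 ≤ (q t).re :=
  let ⟨_, hκ, h1⟩ := H.exists_re_ge hs hst hq
  (mul_nonneg h hκ.le).trans h1

theorem QuadrantInvariant.re_pos (H : QuadrantInvariant a b c d) (hs : 0 ≤ s) (hst : s ≤ t)
    (hq : IsSolutionOn a b c d (Icc s t) q) (h : 0 < (q s).re) : 0 < (q t).re :=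
  let ⟨_, hκ, h1⟩ := H.exists_re_ge hs hst hq
  (mul_pos h hκ).trans_le h1

theorem QuadrantInvariant.nonnegComponents (H : QuadrantInvariant a b c d) (hs : 0 ≤ s)
    (hst : s ≤ t) (hq : IsSolutionOn a b c d (Icc s t) q) (h : NonnegComponents (q s)) :
    NonnegComponents (q t) :=
  ⟨H.re_nonneg hs hst hq h.1, by
    obtain ⟨κ, hκ, h1⟩ := H.exists_neg_imI_ge hs hst hq
    exact (mul_nonneg h.2 hκ.le).trans h1⟩

theorem IsSolutionOn.hasDerivWithinAt_norm_sub_sq {I : Set ℝ} (hq : IsSolutionOn a b c d I q)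
    (hr : IsSolutionOn a b c d I r) (ht : t ∈ I) :
    HasDerivWithinAt (fun x => ‖q x - r x‖ ^ 2)
      (-2 * ((a t * q t).re + (a t * r t).re + ((b t).re + (c t).re)) * ‖q t - r t‖ ^ 2) I t := by
  rw [← inner_rhs_sub (d := d t)]
  exact hasDerivWithinAt_norm_sq ((hq t ht).sub (hr t ht))

theorem QuadrantInvariant.eq_of_eq (H : QuadrantInvariant a b c d) (hs : 0 ≤ s) (hst : s ≤ t)
    (hq : IsSolutionOn a b c d (Icc s t) q) (hr : IsSolutionOn a b c d (Icc s t) r)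
    (h : q s = r s) : q t = r t := by
  have hI := Icc_subset_Ici_zero (t := t) hs
  have hac := H.cont_a.mono hI
  have := le_mul_exp_integral_of_deriv_le hst
    (h := fun x => -2 * ((a x * q x).re + (a x * r x).re + ((b x).re + (c x).re)))
    (ContinuousOn.const_mul (((continuousOn_re (hac.mul hq.continuousOn)).add
      (continuousOn_re (hac.mul hr.continuousOn))).add
      ((continuousOn_re (H.cont_b.mono hI)).add (continuousOn_re (H.cont_c.mono hI)))) _)
    (fun x hx => hq.hasDerivWithinAt_norm_sub_sq hr hx) (fun x _ => le_rfl)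
  rw [h, sub_self, norm_zero, zero_pow two_ne_zero, zero_mul] at this
  have h0 : ‖q t - r t‖ = 0 := by nlinarith [sq_nonneg ‖q t - r t‖]
  exact sub_eq_zero.1 (norm_eq_zero.1 h0)

/-- In the invariant set Re(aq) and Re(ar) are nonnegative and can be dropped, so the growth rate
depends on b₀ + c₀ only. -/
theorem QuadrantInvariant.norm_sub_le (H : QuadrantInvariant a b c d) (hs : 0 ≤ s) (hst : s ≤ t)
    (hq : IsSolutionOn a b c d (Icc s t) q) (hr : IsSolutionOn a b c d (Icc s t) r)
    (hqs : NonnegComponents (q s)) (hrs : NonnegComponents (r s)) {B : ℝ}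
    (hB : ∀ x ∈ Icc s t, -B ≤ (b x).re + (c x).re) :
    ‖q t - r t‖ ≤ ‖q s - r s‖ * Real.exp (B * (t - s)) := by
  have hI := Icc_subset_Ici_zero (t := t) hs
  have := le_mul_exp_integral_of_deriv_le hst (h := fun _ => 2 * B) continuousOn_const
    (fun x hx => hq.hasDerivWithinAt_norm_sub_sq hr hx) (fun x hx => by
      have hsub : Icc s x ⊆ Icc s t := Icc_subset_Icc_right hx.2
      have h1 := re_mul_nonneg (H.a_imJ x (hI hx)) (H.a_imK x (hI hx)) (H.a_re x (hI hx))
        (H.a_imI x (hI hx)) (H.nonnegComponents hs hx.1 (hq.mono hsub) hqs)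
      have h2 := re_mul_nonneg (H.a_imJ x (hI hx)) (H.a_imK x (hI hx)) (H.a_re x (hI hx))
        (H.a_imI x (hI hx)) (H.nonnegComponents hs hx.1 (hr.mono hsub) hrs)
      have h3 := hB x hx
      exact mul_le_mul_of_nonneg_right (by linarith) (sq_nonneg _))
  refine (sq_le_sq₀ (norm_nonneg _) (by positivity)).1 (this.trans_eq ?_)
  rw [mul_pow, ← Real.exp_nat_mul, intervalIntegral.integral_const, smul_eq_mul]
  push_cast
  ring_nf

end Flow

/-! ### Linearization, global existence and normality. -/

/-- `M` bounds all coefficients on the half-line. -/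
def CoeffBound (a b c d : ℝ → ℍ[ℝ]) (M : ℝ) : Prop :=
  ∀ t, 0 ≤ t → ‖a t‖ ≤ M ∧ ‖b t‖ ≤ M ∧ ‖c t‖ ≤ M ∧ ‖d t‖ ≤ M

/-- The linear system `X' = a Y + c X`, `Y' = -b Y - d X`, whose quotients `Y X⁻¹` solve the
Riccati equation. -/
def IsLinearization (a b c d X Y : ℝ → ℍ[ℝ]) : Prop :=
  ∀ t, 0 ≤ t → HasDerivWithinAt X (a t * Y t + c t * X t) (Ici 0) t ∧
    HasDerivWithinAt Y (-(b t * Y t) - d t * X t) (Ici 0) t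

/-- The coefficient of the linear system as a continuous linear map. -/
noncomputable def linearSystem (a b c d : ℍ[ℝ]) : ℍ[ℝ] × ℍ[ℝ] →L[ℝ] ℍ[ℝ] × ℍ[ℝ] :=
  ContinuousLinearMap.inl ℝ ℍ[ℝ] ℍ[ℝ] ∘L
      (ContinuousLinearMap.mul ℝ ℍ[ℝ] a ∘L ContinuousLinearMap.snd ℝ ℍ[ℝ] ℍ[ℝ]
        + ContinuousLinearMap.mul ℝ ℍ[ℝ] c ∘L ContinuousLinearMap.fst ℝ ℍ[ℝ] ℍ[ℝ])
    + ContinuousLinearMap.inr ℝ ℍ[ℝ] ℍ[ℝ] ∘L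
      (-(ContinuousLinearMap.mul ℝ ℍ[ℝ] b ∘L ContinuousLinearMap.snd ℝ ℍ[ℝ] ℍ[ℝ])
        - ContinuousLinearMap.mul ℝ ℍ[ℝ] d ∘L ContinuousLinearMap.fst ℝ ℍ[ℝ] ℍ[ℝ])

theorem linearSystem_apply (a b c d : ℍ[ℝ]) (p : ℍ[ℝ] × ℍ[ℝ]) :
    linearSystem a b c d p = (a * p.2 + c * p.1, -(b * p.2) - d * p.1) := by
  simp [linearSystem]

theorem norm_linearSystem_le {a b c d : ℍ[ℝ]} {M : ℝ} (ha : ‖a‖ ≤ M) (hb : ‖b‖ ≤ M)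
    (hc : ‖c‖ ≤ M) (hd : ‖d‖ ≤ M) : ‖linearSystem a b c d‖ ≤ 2 * M := by
  have hM : 0 ≤ M := (norm_nonneg a).trans ha
  refine ContinuousLinearMap.opNorm_le_bound _ (by positivity) fun p => ?_
  have h1 : ∀ u : ℍ[ℝ], ‖u‖ ≤ M → ∀ v : ℍ[ℝ], ‖v‖ ≤ ‖p‖ → ‖u * v‖ ≤ M * ‖p‖ :=
    fun u hu v hv => by
      rw [norm_mul]
      exact mul_le_mul hu hv (norm_nonneg _) hM
  rw [linearSystem_apply]
  refine max_le ?_ ?_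
  · have := norm_add_le (a * p.2) (c * p.1)
    have := h1 a ha p.2 (norm_snd_le p)
    have := h1 c hc p.1 (norm_fst_le p)
    simp only
    linarith
  · have := norm_sub_le (-(b * p.2)) (d * p.1)
    have := h1 b hb p.2 (norm_snd_le p)
    have := h1 d hd p.1 (norm_fst_le p)
    rw [norm_neg] at *
    simp only
    linarith

section Linear

variable {a b c d X Y : ℝ → ℍ[ℝ]} {M : ℝ}

theorem continuous_comp_max_zero {f : ℝ → ℍ[ℝ]} (hf : ContinuousOn f (Ici 0)) :
    Continuous fun t => f (max t 0) :=
  hf.comp_continuous (by fun_prop) fun _ => mem_Ici.2 (le_max_right _ _)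

theorem QuadrantInvariant.exists_linearization (H : QuadrantInvariant a b c d)
    (hM : CoeffBound a b c d M) (x y : ℍ[ℝ]) :
    ∃ X Y, IsLinearization a b c d X Y ∧ X 0 = x ∧ Y 0 = y := by
  have ha := continuous_comp_max_zero H.cont_a
  have hb := continuous_comp_max_zero H.cont_b
  have hc := continuous_comp_max_zero H.cont_c
  have hd := continuous_comp_max_zero H.cont_d
  obtain ⟨f, hf0, hf⟩ := exists_linearODE_solution
    -- Coefficients are frozen at their value at 0 for negative times, to have them continuous and
    -- bounded on all of ℝ.
    (A := fun t => linearSystem (a (max t 0)) (b (max t 0)) (c (max t 0)) (d (max t 0)))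
    (M := 2 * M) (by
      have hm := (ContinuousLinearMap.mul ℝ ℍ[ℝ]).continuous
      have := hm.comp ha
      have := hm.comp hb
      have := hm.comp hc
      have := hm.comp hd
      unfold linearSystem
      fun_prop)
    (fun t => by
      obtain ⟨h1, h2, h3, h4⟩ := hM (max t 0) (le_max_right _ _)
      exact norm_linearSystem_le h1 h2 h3 h4) (x, y)
  refine ⟨fun t => (f t).1, fun t => (f t).2, fun t ht => ?_, by simp [hf0], by simp [hf0]⟩
  have h := hf t ht
  simp only [max_eq_left ht, linearSystem_apply] at h
  exact ⟨(ContinuousLinearMap.fst ℝ ℍ[ℝ] ℍ[ℝ]).hasFDerivAt.comp_hasDerivWithinAt t h,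
    (ContinuousLinearMap.snd ℝ ℍ[ℝ] ℍ[ℝ]).hasFDerivAt.comp_hasDerivWithinAt t h⟩

theorem IsLinearization.dist_le {X₂ Y₂ : ℝ → ℍ[ℝ]} (h : IsLinearization a b c d X Y)
    (h₂ : IsLinearization a b c d X₂ Y₂) (hM : CoeffBound a b c d M) {t : ℝ} (ht : 0 ≤ t) :
    dist (X t, Y t) (X₂ t, Y₂ t)
      ≤ dist (X 0, Y 0) (X₂ 0, Y₂ 0) * Real.exp (2 * M * t) := by
  have hM0 : 0 ≤ M := (norm_nonneg _).trans (hM 0 le_rfl).1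
  have key : ∀ {X Y : ℝ → ℍ[ℝ]}, IsLinearization a b c d X Y → ∀ x, 0 ≤ x →
      HasDerivWithinAt (fun x => (X x, Y x))
        (linearSystem (a (max x 0)) (b (max x 0)) (c (max x 0)) (d (max x 0)) (X x, Y x))
        (Ici 0) x := fun h x hx => by
    rw [max_eq_left hx, linearSystem_apply]
    exact (h x hx).1.prodMk (h x hx).2
  have := dist_le_of_trajectories_ODE (a := 0) (b := t) (K := ⟨2 * M, by positivity⟩)
    (v := fun x p => linearSystem (a (max x 0)) (b (max x 0)) (c (max x 0)) (d (max x 0)) p)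
    (fun x => by
      obtain ⟨h1, h2, h3, h4⟩ := hM (max x 0) (le_max_right _ _)
      exact (ContinuousLinearMap.lipschitz _).weaken (norm_linearSystem_le h1 h2 h3 h4))
    (fun x hx => ((key h x hx.1).mono Icc_subset_Ici_self).continuousWithinAt)
    (fun x hx => (key h x hx.1).mono (Ici_subset_Ici.2 hx.1))
    (fun x hx => ((key h₂ x hx.1).mono Icc_subset_Ici_self).continuousWithinAt)
    (fun x hx => (key h₂ x hx.1).mono (Ici_subset_Ici.2 hx.1)) le_rfl t (right_mem_Icc.2 ht)
  rwa [sub_zero] at this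

theorem IsLinearization.isSolutionOn (h : IsLinearization a b c d X Y) {I : Set ℝ}
    (hI : I ⊆ Ici 0) (hX : ∀ t ∈ I, X t ≠ 0) :
    IsSolutionOn a b c d I fun t => Y t * (X t)⁻¹ := by
  intro t ht
  obtain ⟨h1, h2⟩ := h t (hI ht)
  refine ((h2.mono hI).mul (hasDerivWithinAt_inv (h1.mono hI) (hX t ht))).congr_deriv ?_
  have h0 := hX t ht
  have e : X t * (X t)⁻¹ = 1 := mul_inv_cancel₀ h0
  simp only [mul_add, add_mul, sub_mul, mul_neg, neg_mul, neg_add, mul_assoc, e, mul_one]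
  abel

theorem inner_mul_self (z x : ℍ[ℝ]) :
    x.re * (z * x).re + x.imI * (z * x).imI + x.imJ * (z * x).imJ + x.imK * (z * x).imK
      = z.re * ‖x‖ ^ 2 := by
  rw [norm_sq_eq_components]
  simp
  ring

/-- Before the first zero u of X, the quotient q = Y X⁻¹ is a solution in the invariant set and X' =
(aq + c)X. As Re(aq) ≥ 0, |X|² decays at most like exp(-2Mt), so it cannot reach 0 at u. -/
theorem IsLinearization.ne_zero (H : QuadrantInvariant a b c d) (hM : CoeffBound a b c d M)
    (h : IsLinearization a b c d X Y) {s t : ℝ} (hs : 0 ≤ s) (hst : s ≤ t) (hX : X s ≠ 0)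
    (hq : NonnegComponents (Y s * (X s)⁻¹)) : X t ≠ 0 := by
  intro ht
  have hXc : ContinuousOn X (Icc s t) := fun x hx =>
    ((h x (hs.trans hx.1)).1.mono (Icc_subset_Ici_zero hs)).continuousWithinAt
  have hcl : IsClosed (Icc s t ∩ X ⁻¹' {0}) :=
    hXc.preimage_isClosed_of_isClosed isClosed_Icc isClosed_singleton
  obtain ⟨u, ⟨hu, hu0 : X u = 0⟩, hmin⟩ :=
    (isCompact_Icc.of_isClosed_subset hcl inter_subset_left).exists_isLeast
      ⟨t, right_mem_Icc.2 hst, ht⟩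
  have hne : ∀ x ∈ Ico s u, X x ≠ 0 := fun x hx h0 =>
    (hmin ⟨⟨hx.1, hx.2.le.trans hu.2⟩, h0⟩).not_gt hx.2
  have hIu : Icc s u ⊆ Ici 0 := Icc_subset_Ici_zero hs
  have hsol := h.isSolutionOn (Ico_subset_Icc_self.trans hIu) hne
  have hle := mul_exp_integral_le_of_le_deriv (f := fun x => ‖X x‖ ^ 2) (h := fun _ => -2 * M)
    hu.1 continuousOn_const (fun x hx => hasDerivWithinAt_norm_sq ((h x (hIu hx)).1.mono hIu))
    fun x hx => by
      rcases hx.2.eq_or_lt with hxu | hxu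
      · simp [hxu, hu0]
      · have hX0 := hne x ⟨hx.1, hxu⟩
        have e : a x * Y x + c x * X x = (a x * (Y x * (X x)⁻¹) + c x) * X x := by
          simp only [add_mul, mul_assoc, inv_mul_cancel₀ hX0, mul_one]
        have hxq := H.nonnegComponents hs hx.1
          (hsol.mono (Icc_subset_Ico_right hxu)) hq
        have hpos := re_mul_nonneg (H.a_imJ x (hIu hx)) (H.a_imK x (hIu hx))
          (H.a_re x (hIu hx)) (H.a_imI x (hIu hx)) hxq
        have hc := (abs_le.1 ((abs_re_le_norm (c x)).trans (hM x (hIu hx)).2.2.1)).1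
        rw [e, inner_mul_self, ← mul_assoc, Quaternion.re_add]
        exact mul_le_mul_of_nonneg_right (by linarith) (sq_nonneg _)
  simp only [hu0, norm_zero, ne_eq, OfNat.ofNat_ne_zero, not_false_eq_true, zero_pow] at hle
  exact hle.not_gt (mul_pos (pow_pos (norm_pos_iff.2 hX) 2) (Real.exp_pos _))

theorem QuadrantInvariant.exists_solution (H : QuadrantInvariant a b c d)
    (hM : CoeffBound a b c d M) {x : ℍ[ℝ]} (hx : NonnegComponents x) :
    ∃ q, IsSolutionOn a b c d (Ici 0) q ∧ q 0 = x := by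
  obtain ⟨X, Y, h, h0, h1⟩ := H.exists_linearization hM 1 x
  exact ⟨_, h.isSolutionOn subset_rfl fun t ht => h.ne_zero H hM le_rfl ht (by simp [h0])
    (by simpa [h0, h1] using hx), by simp [h0, h1]⟩

theorem QuadrantInvariant.eqOn (H : QuadrantInvariant a b c d) {q r : ℝ → ℍ[ℝ]} {τ : ℝ}
    (hq : IsSolutionOn a b c d (Ici 0) q) (hr : IsSolutionOn a b c d (Ico 0 τ) r)
    (h : q 0 = r 0) : EqOn q r (Ico 0 τ) := fun _ ht =>
  H.eq_of_eq le_rfl ht.1 (hq.mono Icc_subset_Ici_self) (hr.mono (Icc_subset_Ico_right ht.2)) h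

/-- Nearby initial values may lie outside the invariant set. On the compact interval [0, t₁] their X
stays nonzero by uniform closeness; at t₁ the quotient is near the interior point q(t₁), and from
then on invariance takes over. -/
theorem QuadrantInvariant.isNormal (H : QuadrantInvariant a b c d) (hM : CoeffBound a b c d M)
    {q : ℝ → ℍ[ℝ]} (hq : IsSolutionOn a b c d (Ici 0) q) (hq0 : NonnegComponents (q 0))
    {t₁ : ℝ} (ht₁ : 0 ≤ t₁) (h0 : 0 < (q t₁).re) (h1 : 0 < -(q t₁).imI) :
    IsNormal a b c d 0 q := by
  choose X Y hXY hX0 hY0 using fun x => H.exists_linearization hM 1 x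
  have hne : ∀ t, 0 ≤ t → X (q 0) t ≠ 0 := fun t ht =>
    (hXY _).ne_zero H hM le_rfl ht (by simp [hX0]) (by simpa [hX0, hY0] using hq0)
  have hqt : q t₁ = Y (q 0) t₁ * (X (q 0) t₁)⁻¹ := by
    have hsol := (hXY (q 0)).isSolutionOn subset_rfl hne
    exact H.eq_of_eq le_rfl ht₁ (hq.mono Icc_subset_Ici_self) (hsol.mono Icc_subset_Ici_self)
      (by simp [hX0, hY0])
  have hXc : ContinuousOn (X (q 0)) (Icc 0 t₁) := fun x hx =>
    ((hXY (q 0) x hx.1).1.mono Icc_subset_Ici_self).continuousWithinAt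
  obtain ⟨u, hu, hmin⟩ := isCompact_Icc.exists_isMinOn (nonempty_Icc.2 ht₁) hXc.norm
  have hM0 : 0 ≤ M := (norm_nonneg _).trans (hM 0 le_rfl).1
  have hdist : ∀ x, ∀ t ∈ Icc 0 t₁, dist (X x t, Y x t) (X (q 0) t, Y (q 0) t)
      ≤ dist x (q 0) * Real.exp (2 * M * t₁) := fun x t ht => by
    refine ((hXY x).dist_le (hXY (q 0)) hM ht.1).trans ?_
    rw [hX0, hX0, hY0, hY0, Prod.dist_eq, dist_self, max_eq_right dist_nonneg]
    gcongr
    exact ht.2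
  have hlim : Tendsto (fun x => dist x (q 0) * Real.exp (2 * M * t₁)) (𝓝 (q 0)) (𝓝 0) := by
    have : Continuous fun x => dist x (q 0) * Real.exp (2 * M * t₁) := by fun_prop
    simpa using this.tendsto (q 0)
  have hpair : Tendsto (fun x => (X x t₁, Y x t₁)) (𝓝 (q 0)) (𝓝 (X (q 0) t₁, Y (q 0) t₁)) :=
    tendsto_iff_dist_tendsto_zero.2 (squeeze_zero (fun _ => dist_nonneg)
      (fun x => hdist x t₁ (right_mem_Icc.2 ht₁)) hlim)
  have hquot : Tendsto (fun x => Y x t₁ * (X x t₁)⁻¹) (𝓝 (q 0)) (𝓝 (q t₁)) := by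
    rw [hqt]
    rw [nhds_prod_eq] at hpair
    exact hpair.snd.mul (hpair.fst.inv₀ (hne t₁ ht₁))
  have hev1 : ∀ᶠ x in 𝓝 (q 0), ∀ t ∈ Icc 0 t₁, X x t ≠ 0 := by
    -- A perturbation smaller than the minimum ‖X(u)‖ over [0, t₁] cannot create a zero.
    filter_upwards [hlim.eventually (gt_mem_nhds (norm_pos_iff.2 (hne u hu.1)))] with x hx t ht h
    have h2 : ‖X (q 0) u‖ ≤ ‖X (q 0) t‖ := hmin ht
    have h3 := (le_max_left _ _).trans (hdist x t ht)
    simp only [h, dist_zero_left] at h3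
    linarith
  have hev2 : ∀ᶠ x in 𝓝 (q 0), NonnegComponents (Y x t₁ * (X x t₁)⁻¹) := by
    filter_upwards [((Quaternion.continuous_re.tendsto _).comp hquot).eventually (lt_mem_nhds h0),
      ((Quaternion.continuous_imI.neg.tendsto _).comp hquot).eventually (lt_mem_nhds h1)]
      with x hx hx'
    exact ⟨le_of_lt hx, le_of_lt hx'⟩
  refine ⟨hq, _, hev1.and hev2, fun τ _ r hr hr0 => ?_⟩
  obtain ⟨hr1, hr2⟩ := hr0
  have hsol := (hXY (r 0)).isSolutionOn subset_rfl fun t ht => by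
    rcases le_total t t₁ with h | h
    · exact hr1 t ⟨ht, h⟩
    · exact (hXY (r 0)).ne_zero H hM ht₁ h (hr1 t₁ (right_mem_Icc.2 ht₁)) hr2
  exact ⟨_, hsol, H.eqOn hsol hr (by simp [hX0, hY0])⟩

end Linear

/-! ### Periodicity and boundedness of solutions. -/

/-- The coefficients are `T`-periodic with `T > 0`. -/
structure PeriodicCoeffs (T : ℝ) (a b c d : ℝ → ℍ[ℝ]) : Prop where
  pos : 0 < T
  a : PeriodicOnHalfLine T a
  b : PeriodicOnHalfLine T b
  c : PeriodicOnHalfLine T c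
  d : PeriodicOnHalfLine T d

section Periodic

variable {T : ℝ} {f : ℝ → ℍ[ℝ]}

theorem exists_eq_add_nat_mul (hT : 0 < T) {t : ℝ} (ht : 0 ≤ t) :
    ∃ n : ℕ, ∃ s, 0 ≤ s ∧ s < T ∧ t = s + n * T := by
  refine ⟨⌊t / T⌋₊, t - ⌊t / T⌋₊ * T, ?_, ?_, by ring⟩
  · linarith [(le_div_iff₀ hT).1 (Nat.floor_le (div_nonneg ht hT.le))]
  · linarith [(div_lt_iff₀ hT).1 (Nat.lt_floor_add_one (t / T))]

theorem PeriodicOnHalfLine.nat_mul (hf : PeriodicOnHalfLine T f) (hT : 0 < T) (n : ℕ) {t : ℝ}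
    (ht : 0 ≤ t) : f (t + n * T) = f t := by
  induction n with
  | zero => simp
  | succ n ih =>
    rw [show t + ((n + 1 : ℕ) : ℝ) * T = t + n * T + T by push_cast; ring,
      hf _ (by positivity), ih]

theorem PeriodicOnHalfLine.exists_norm_le (hf : PeriodicOnHalfLine T f) (hT : 0 < T)
    (hc : ContinuousOn f (Ici 0)) : ∃ M, ∀ t, 0 ≤ t → ‖f t‖ ≤ M := by
  obtain ⟨M, hM⟩ := isCompact_Icc.exists_bound_of_continuousOn
    (hc.mono (Icc_subset_Ici_zero (t := T) le_rfl))
  refine ⟨M, fun t ht => ?_⟩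
  obtain ⟨n, s, hs, hsT, rfl⟩ := exists_eq_add_nat_mul hT ht
  rw [hf.nat_mul hT n hs]
  exact hM s ⟨hs, hsT.le⟩

end Periodic

section Bounds

variable {T M : ℝ} {a b c d q : ℝ → ℍ[ℝ]}

theorem PeriodicCoeffs.exists_coeffBound (P : PeriodicCoeffs T a b c d)
    (H : QuadrantInvariant a b c d) : ∃ M, CoeffBound a b c d M := by
  obtain ⟨A, hA⟩ := P.a.exists_norm_le P.pos H.cont_a
  obtain ⟨B, hB⟩ := P.b.exists_norm_le P.pos H.cont_b
  obtain ⟨C, hC⟩ := P.c.exists_norm_le P.pos H.cont_c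
  obtain ⟨D, hD⟩ := P.d.exists_norm_le P.pos H.cont_d
  refine ⟨max (max A B) (max C D), fun t ht => ⟨?_, ?_, ?_, ?_⟩⟩
  · exact (hA t ht).trans (by simp)
  · exact (hB t ht).trans (by simp)
  · exact (hC t ht).trans (by simp)
  · exact (hD t ht).trans (by simp)

theorem IsSolutionOn.shift (P : PeriodicCoeffs T a b c d)
    (hq : IsSolutionOn a b c d (Ici 0) q) (n : ℕ) :
    IsSolutionOn a b c d (Ici 0) fun t => q (t + n * T) := by
  intro t ht
  have hnT : 0 ≤ n * T := mul_nonneg n.cast_nonneg P.pos.le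
  have h := hq (t + n * T) (add_nonneg ht hnT)
  rw [P.a.nat_mul P.pos n ht, P.b.nat_mul P.pos n ht, P.c.nat_mul P.pos n ht,
    P.d.nat_mul P.pos n ht] at h
  have := h.scomp t ((hasDerivWithinAt_id t (Ici 0)).add_const (n * T))
    fun x hx => add_nonneg hx hnT
  simpa using! this

/-- The quadratic term has a favourable sign in the invariant set. The bound b₀ + c₀ ≥ -2M costs 4M,
and Young's inequality for the d term costs |q|² + M²; adding 1 to |q|² absorbs the constant M². -/
theorem QuadrantInvariant.norm_sq_add_one_le (H : QuadrantInvariant a b c d)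
    (hM : CoeffBound a b c d M) {s t : ℝ} (hs : 0 ≤ s) (hst : s ≤ t)
    (hq : IsSolutionOn a b c d (Icc s t) q) (hqs : NonnegComponents (q s)) :
    ‖q t‖ ^ 2 + 1 ≤ (‖q s‖ ^ 2 + 1) * Real.exp ((4 * M + 1 + M ^ 2) * (t - s)) := by
  have hI := Icc_subset_Ici_zero (t := t) hs
  have hM0 : 0 ≤ M := (norm_nonneg _).trans (hM 0 le_rfl).1
  have := le_mul_exp_integral_of_deriv_le (f := fun x => ‖q x‖ ^ 2 + 1) hst
    (h := fun _ => 4 * M + 1 + M ^ 2) continuousOn_const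
    (fun x hx => (hasDerivWithinAt_norm_sq (hq x hx)).add_const 1) fun x hx => by
      rw [inner_rhs]
      obtain ⟨-, hb, hc, hd⟩ := hM x (hI hx)
      have h1 := re_mul_nonneg (H.a_imJ x (hI hx)) (H.a_imK x (hI hx)) (H.a_re x (hI hx))
        (H.a_imI x (hI hx)) (H.nonnegComponents hs hx.1
          (hq.mono (Icc_subset_Icc_right hx.2)) hqs)
      have h2 := (abs_le.1 ((abs_re_le_norm (b x)).trans hb)).1
      have h3 := (abs_le.1 ((abs_re_le_norm (c x)).trans hc)).1
      have h4 : ‖d x‖ ^ 2 ≤ M ^ 2 := by gcongr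
      have h5 : -2 * ((a x * q x).re + ((b x).re + (c x).re)) * ‖q x‖ ^ 2
          ≤ 4 * M * ‖q x‖ ^ 2 :=
        mul_le_mul_of_nonneg_right (by linarith) (sq_nonneg _)
      have h6 : -2 * ((q x).re * (d x).re + (q x).imI * (d x).imI + (q x).imJ * (d x).imJ
          + (q x).imK * (d x).imK) ≤ ‖q x‖ ^ 2 + ‖d x‖ ^ 2 := by
        rw [norm_sq_eq_components, norm_sq_eq_components]
        linarith [sq_nonneg ((q x).re + (d x).re), sq_nonneg ((q x).imI + (d x).imI),
          sq_nonneg ((q x).imJ + (d x).imJ), sq_nonneg ((q x).imK + (d x).imK)]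
      have h7 : 0 ≤ M ^ 2 * ‖q x‖ ^ 2 := by positivity
      linarith
  rwa [intervalIntegral.integral_const, smul_eq_mul, mul_comm (t - s)] at this

/-- If |q| > R throughout, p = q⁻¹ satisfies p' = a + O(1/R), so the sum of its first two components
must grow by about ∫(a₀ + a₁) > 0, although it stays within 2/R of 0. -/
theorem exists_norm_le_of_isSolutionOn_period (hT : 0 < T) (H : QuadrantInvariant a b c d)
    (hM : CoeffBound a b c d M) {u : ℝ} (hu : u ∈ Icc 0 T) (hau : 0 < (a u).re + (a u).imI) :
    ∃ R, ∀ q, IsSolutionOn a b c d (Icc 0 T) q → ∃ t ∈ Icc 0 T, ‖q t‖ ≤ R := by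
  have hM0 : 0 ≤ M := (norm_nonneg _).trans (hM 0 le_rfl).1
  have hI : Icc 0 T ⊆ Ici 0 := Icc_subset_Ici_self
  have hac : ContinuousOn (fun t => (a t).re + (a t).imI) (Icc 0 T) :=
    ((continuousOn_re H.cont_a).add (continuousOn_imI H.cont_a)).mono hI
  have hpos : 0 < ∫ t in (0 : ℝ)..T, ((a t).re + (a t).imI) :=
    intervalIntegral.integral_pos hT hac
      (fun t ht => add_nonneg (H.a_re t ht.1.le) (H.a_imI t ht.1.le)) ⟨u, hu, hau⟩
  set m := ∫ t in (0 : ℝ)..T, ((a t).re + (a t).imI)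
  -- End-point values contribute at most 4/R and the error terms at most 6MT/R; the summand 1 makes
  -- mR exceed their total 4 + 6MT, and also gives 1/R ≤ 1.
  set R := 1 + (4 + 6 * M * T) / m with hR
  have hR1 : 1 ≤ R := by rw [hR, le_add_iff_nonneg_right]; positivity
  have hR0 : 0 < R := by linarith
  refine ⟨R, fun q hq => ?_⟩
  by_contra! hcon
  have hinv : ∀ t ∈ Icc 0 T, ‖(q t)⁻¹‖ ≤ R⁻¹ := fun t ht => by
    rw [norm_inv]
    exact inv_anti₀ hR0 (hcon t ht).le
  have hq0 : ∀ t ∈ Icc 0 T, q t ≠ 0 := fun t ht =>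
    norm_pos_iff.1 (hR0.trans (hcon t ht))
  have hder : ∀ t ∈ Icc 0 T, HasDerivWithinAt (fun t => (q t)⁻¹)
      (a t + ((q t)⁻¹ * b t + c t * (q t)⁻¹ + (q t)⁻¹ * d t * (q t)⁻¹)) (Icc 0 T) t := by
    intro t ht
    refine (hasDerivWithinAt_inv (hq t ht) (hq0 t ht)).congr_deriv ?_
    have e1 : (q t)⁻¹ * q t = 1 := inv_mul_cancel₀ (hq0 t ht)
    have e2 : q t * (q t)⁻¹ = 1 := mul_inv_cancel₀ (hq0 t ht)
    have : -((q t)⁻¹ * -(q t * a t * q t + b t * q t + q t * c t + d t) * (q t)⁻¹)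
        = ((q t)⁻¹ * q t) * a t * (q t * (q t)⁻¹) + ((q t)⁻¹ * b t * (q t * (q t)⁻¹)
          + ((q t)⁻¹ * q t) * c t * (q t)⁻¹ + (q t)⁻¹ * d t * (q t)⁻¹) := by noncomm_ring
    rw [this, e1, e2]
    simp
  have herr : ∀ t ∈ Icc 0 T,
      ‖(q t)⁻¹ * b t + c t * (q t)⁻¹ + (q t)⁻¹ * d t * (q t)⁻¹‖ ≤ 3 * M * R⁻¹ := by
    intro t ht
    obtain ⟨-, hb, hc, hd⟩ := hM t (hI ht)
    have hi := hinv t ht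
    have hi1 : ‖(q t)⁻¹‖ ≤ 1 := hi.trans (inv_le_one_of_one_le₀ hR1)
    have h1 : ‖(q t)⁻¹ * b t‖ ≤ R⁻¹ * M := by
      rw [norm_mul]
      gcongr
    have h2 : ‖c t * (q t)⁻¹‖ ≤ M * R⁻¹ := by
      rw [norm_mul]
      gcongr
    have h3 : ‖(q t)⁻¹ * d t * (q t)⁻¹‖ ≤ 1 * M * R⁻¹ := by
      rw [norm_mul, norm_mul]
      gcongr
    have := norm_add₃_le (a := (q t)⁻¹ * b t) (b := c t * (q t)⁻¹)
      (c := (q t)⁻¹ * d t * (q t)⁻¹)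
    linarith
  have hfd : ∀ t ∈ Icc 0 T, HasDerivWithinAt (fun t => ((q t)⁻¹).re + ((q t)⁻¹).imI) _
      (Icc 0 T) t := fun t ht =>
    (hasDerivWithinAt_re (hder t ht)).add (hasDerivWithinAt_imI (hder t ht))
  have hle := intervalIntegral.integral_le_sub_of_hasDeriv_right_of_le hT.le
    (φ := fun t => (a t).re + (a t).imI - 6 * M * R⁻¹)
    (fun t ht => (hfd t ht).continuousWithinAt)
    (fun t ht => ((hfd t (Ioo_subset_Icc_self ht)).hasDerivAt
      (Icc_mem_nhds ht.1 ht.2)).hasDerivWithinAt)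
    ((hac.sub continuousOn_const).integrableOn_Icc) fun t ht => by
      have ht' := Ioo_subset_Icc_self ht
      have h1 := (abs_le.1 ((abs_re_le_norm _).trans (herr t ht'))).1
      have h2 := (abs_le.1 ((abs_imI_le_norm _).trans (herr t ht'))).1
      rw [Quaternion.re_add (a t), Quaternion.imI_add (a t)]
      linarith
  rw [intervalIntegral.integral_sub (hac.intervalIntegrable_of_Icc hT.le) (by simp),
    intervalIntegral.integral_const, smul_eq_mul, sub_zero] at hle
  have h1 := (abs_le.1 ((abs_re_le_norm _).trans (hinv 0 (left_mem_Icc.2 hT.le)))).1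
  have h2 := (abs_le.1 ((abs_imI_le_norm _).trans (hinv 0 (left_mem_Icc.2 hT.le)))).1
  have h3 := (abs_le.1 ((abs_re_le_norm _).trans (hinv T (right_mem_Icc.2 hT.le)))).2
  have h4 := (abs_le.1 ((abs_imI_le_norm _).trans (hinv T (right_mem_Icc.2 hT.le)))).2
  have h5 : m * R ≤ 4 + 6 * M * T := by
    have : m ≤ (4 + 6 * M * T) * R⁻¹ := by linarith
    rwa [← div_eq_mul_inv, le_div_iff₀ hR0] at this
  have h6 : m * R = m + (4 + 6 * M * T) := by
    rw [hR]
    field_simp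
  linarith

theorem QuadrantInvariant.exists_norm_le (H : QuadrantInvariant a b c d)
    (P : PeriodicCoeffs T a b c d) (ha : ∃ t, 0 ≤ t ∧ (a t).re + (a t).imI ≠ 0)
    (hq : IsSolutionOn a b c d (Ici 0) q) (hq0 : NonnegComponents (q 0)) :
    ∃ R, ∀ t, 0 ≤ t → ‖q t‖ ≤ R := by
  obtain ⟨M, hM⟩ := P.exists_coeffBound H
  have hM0 : 0 ≤ M := (norm_nonneg _).trans (hM 0 le_rfl).1
  obtain ⟨w, hw, haw⟩ := ha
  obtain ⟨n, u, hu, huT, rfl⟩ := exists_eq_add_nat_mul P.pos hw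
  rw [P.a.nat_mul P.pos n hu] at haw
  obtain ⟨R, hR⟩ := exists_norm_le_of_isSolutionOn_period P.pos H hM ⟨hu, huT.le⟩
    (haw.symm.lt_of_le (add_nonneg (H.a_re u hu) (H.a_imI u hu)))
  set k := 4 * M + 1 + M ^ 2
  have hk : 0 ≤ k := by positivity
  have key : ∀ s t, 0 ≤ s → s ≤ t → t ≤ s + 2 * T → ∀ m, ‖q s‖ ^ 2 ≤ m →
      ‖q t‖ ≤ (m + 1) * Real.exp (k * (2 * T)) := by
    intro s t hs hst hts m hm
    have h1 := H.norm_sq_add_one_le hM hs hst (hq.mono (Icc_subset_Ici_zero hs))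
      (H.nonnegComponents le_rfl hs (hq.mono Icc_subset_Ici_self) hq0)
    have h2 : (‖q s‖ ^ 2 + 1) * Real.exp (k * (t - s))
        ≤ (m + 1) * Real.exp (k * (2 * T)) := by
      have : t - s ≤ 2 * T := by linarith
      have : 0 ≤ m := (sq_nonneg _).trans hm
      gcongr
    nlinarith [sq_nonneg (‖q t‖ - 1)]
  refine ⟨max ((‖q 0‖ ^ 2 + 1) * Real.exp (k * (2 * T)))
    ((R ^ 2 + 1) * Real.exp (k * (2 * T))), fun t ht => ?_⟩
  obtain ⟨n, s, hs, hsT, rfl⟩ := exists_eq_add_nat_mul P.pos ht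
  have hT := P.pos
  -- After the first period, the starting point is a time of the preceding period at which |q| ≤ R;
  -- the gap is then at most 2T.
  rcases n with - | n
  · exact le_max_of_le_left (key 0 _ le_rfl ht (by push_cast; linarith) _ le_rfl)
  · obtain ⟨v, hv, hvR⟩ := hR _ ((hq.shift P n).mono Icc_subset_Ici_self)
    have hnT : 0 ≤ n * T := mul_nonneg n.cast_nonneg hT.le
    refine le_max_of_le_right (key (v + n * T) _ (add_nonneg hv.1 hnT) ?_ ?_ _ ?_)
    · push_cast; linarith [hv.2]
    · push_cast; linarith [hv.1]
    · gcongr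

end Bounds

/-! ### Strict entry into the interior. -/

section Strict

variable {a b c d q r : ℝ → ℍ[ℝ]} {t T R : ℝ}

theorem QuadrantInvariant.D₀_nonpos (H : QuadrantInvariant a b c d) (ht : 0 ≤ t) :
    D₀ a b c d t ≤ 0 := by
  unfold D₀
  split_ifs
  · exact H.disc₀ t ht
  · linarith [H.d_re t ht]

theorem quadratic_pos_of_discrim_nonpos {α δ p₁ p₂ p₃ x₁ x₂ x₃ : ℝ} (hα : 0 ≤ α) (hδ : δ ≤ 0)
    (h : p₁ ^ 2 + p₂ ^ 2 + p₃ ^ 2 + 4 * α * δ ≤ 0)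
    (hne : (if α ≠ 0 then p₁ ^ 2 + p₂ ^ 2 + p₃ ^ 2 + 4 * α * δ else 4 * δ) ≠ 0) :
    0 < α * (x₁ ^ 2 + x₂ ^ 2 + x₃ ^ 2) + p₁ * x₁ + p₂ * x₂ + p₃ * x₃ - δ := by
  obtain ⟨h1, h2⟩ := quadratic_nonneg_of_discrim_nonpos (x₁ := x₁) (x₂ := x₂) (x₃ := x₃) hα hδ h
  refine h2.lt_of_ne fun h0 => hne ?_
  split_ifs with hα0
  · rw [← h0] at h1
    linarith
  · obtain rfl : α = 0 := not_not.1 hα0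
    have e1 : p₁ = 0 := by nlinarith [sq_nonneg p₁, sq_nonneg p₂, sq_nonneg p₃]
    have e2 : p₂ = 0 := by nlinarith [sq_nonneg p₁, sq_nonneg p₂, sq_nonneg p₃]
    have e3 : p₃ = 0 := by nlinarith [sq_nonneg p₁, sq_nonneg p₂, sq_nonneg p₃]
    rw [e1, e2, e3] at h0
    linarith

theorem QuadrantInvariant.inward₀_pos (H : QuadrantInvariant a b c d) (ht : 0 ≤ t)
    (hD : D₀ a b c d t ≠ 0) (x : ℍ[ℝ]) : 0 < inward₀ (a t) (b t) (c t) (d t) x :=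
  quadratic_pos_of_discrim_nonpos (H.a_re t ht) (H.d_re t ht) (H.disc₀ t ht) hD

theorem QuadrantInvariant.inward₁_pos (H : QuadrantInvariant a b c d) (ht : 0 ≤ t)
    (hD : D₁ a b c d t ≠ 0) (x : ℍ[ℝ]) : 0 < inward₁ (a t) (b t) (c t) (d t) x := by
  have := quadratic_pos_of_discrim_nonpos (α := (a t).imI) (δ := -(d t).imI)
    (p₁ := (b t).imI + (c t).imI) (p₂ := (b t).imJ - (c t).imJ) (p₃ := (b t).imK - (c t).imK)
    (x₁ := x.re) (x₂ := x.imK) (x₃ := -x.imJ)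
    (H.a_imI t ht) (by linarith [H.d_imI t ht]) (by linarith [H.disc₁ t ht]) (by
      unfold D₁ at hD
      convert hD using 2 <;> ring)
  unfold inward₁
  linarith

/-- A function with positive derivative at `s` does not vanish identically on `[s, t]`. -/
theorem false_of_hasDerivWithinAt_pos {f : ℝ → ℝ} {f' s t : ℝ} (hst : s < t)
    (hf : HasDerivWithinAt f f' (Icc s t) s) (h0 : ∀ x ∈ Icc s t, f x = 0) (hf' : 0 < f') :
    False := by
  have h1 : HasDerivWithinAt f 0 (Icc s t) s :=
    (hasDerivWithinAt_const s (Icc s t) (0 : ℝ)).congr h0 (h0 s (left_mem_Icc.2 hst.le))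
  exact hf'.ne' ((uniqueDiffOn_Icc hst s (left_mem_Icc.2 hst.le)).eq_deriv _ hf h1)

/-- Positivity of q₀ persists once attained, so q₀(t) = 0 would force q₀ ≡ 0 on [s, t], against its
derivative `inward₀ > 0` at s. -/
theorem QuadrantInvariant.re_pos_of_D₀ (H : QuadrantInvariant a b c d) {s : ℝ} (hs : 0 ≤ s)
    (hst : s < t) (hD : D₀ a b c d s ≠ 0) (hq : IsSolutionOn a b c d (Ici 0) q)
    (hq0 : 0 ≤ (q 0).re) : 0 < (q t).re := by
  by_contra! hcon
  have h0 : ∀ x ∈ Icc s t, (q x).re = 0 := fun x hx => by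
    have hx0 := hs.trans hx.1
    refine le_antisymm (not_lt.1 fun h => hcon.not_gt ?_)
      (H.re_nonneg le_rfl hx0 (hq.mono Icc_subset_Ici_self) hq0)
    exact H.re_pos hx0 hx.2 (hq.mono (Icc_subset_Ici_zero hx0)) h
  refine false_of_hasDerivWithinAt_pos hst
    ((hasDerivWithinAt_re (hq s hs)).mono (Icc_subset_Ici_zero hs)) h0 ?_
  rw [rhs_re (H.a_imJ s hs) (H.a_imK s hs), h0 s (left_mem_Icc.2 hst.le), mul_zero, zero_add]
  exact H.inward₀_pos hs hD _

theorem QuadrantInvariant.neg_imI_pos_of_D₁ (H : QuadrantInvariant a b c d) {s : ℝ} (hs : 0 ≤ s)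
    (hst : s < t) (hD : D₁ a b c d s ≠ 0) (hq : IsSolutionOn a b c d (Ici 0) q)
    (hq0 : 0 ≤ -(q 0).imI) : 0 < -(q t).imI := by
  by_contra! hcon
  have h0 : ∀ x ∈ Icc s t, -(q x).imI = 0 := fun x hx => by
    have hx0 := hs.trans hx.1
    refine le_antisymm (not_lt.1 fun h => hcon.not_gt ?_) ?_
    · obtain ⟨κ, hκ, h1⟩ := H.exists_neg_imI_ge hx0 hx.2 (hq.mono (Icc_subset_Ici_zero hx0))
      exact (mul_pos h hκ).trans_le h1
    · obtain ⟨κ, hκ, h1⟩ := H.exists_neg_imI_ge le_rfl hx0 (hq.mono Icc_subset_Ici_self)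
      exact (mul_nonneg hq0 hκ.le).trans h1
  refine false_of_hasDerivWithinAt_pos hst
    ((hasDerivWithinAt_imI (hq s hs)).neg.mono (Icc_subset_Ici_zero hs)) h0 ?_
  rw [rhs_imI (H.a_imJ s hs) (H.a_imK s hs), h0 s (left_mem_Icc.2 hst.le), mul_zero, zero_add]
  exact H.inward₁_pos hs hD _

/-- On a ball, `inward₀` is bounded below by a nonnegative continuous function which is positive
where `D₀` is nonzero. -/
theorem QuadrantInvariant.exists_le_inward₀ (H : QuadrantInvariant a b c d) (R : ℝ) (ht : 0 ≤ t)
    (hD : D₀ a b c d t ≠ 0) :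
    ∃ γ : ℝ → ℝ, ContinuousOn γ (Ici 0) ∧ 0 < γ t ∧ ∀ x, 0 ≤ x → 0 ≤ γ x ∧
      ∀ y : ℍ[ℝ], ‖y‖ ≤ R → γ x ≤ inward₀ (a x) (b x) (c x) (d x) y := by
  have ha := continuousOn_re H.cont_a
  have hd := continuousOn_re H.cont_d
  have hp : ContinuousOn (fun x => ((b x).imI + (c x).imI) ^ 2 + ((b x).imJ + (c x).imJ) ^ 2
      + ((b x).imK + (c x).imK) ^ 2) (Ici 0) :=
    ((((continuousOn_imI H.cont_b).add (continuousOn_imI H.cont_c)).pow 2).add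
      (((continuousOn_imJ H.cont_b).add (continuousOn_imJ H.cont_c)).pow 2)).add
      (((continuousOn_imK H.cont_b).add (continuousOn_imK H.cont_c)).pow 2)
  have hDle := (H.D₀_nonpos ht).lt_of_ne hD
  -- `D₀` may jump at zeros of a₀, so the continuous lower bound is chosen by cases. If a₀(t) = 0,
  -- the discriminant condition forces p(t) = 0, and the Cauchy–Schwarz bound -d₀ - R|p| is positive
  -- at t.
  by_cases hat : (a t).re = 0
  · set p : ℝ → ℝ := fun x => √(((b x).imI + (c x).imI) ^ 2 + ((b x).imJ + (c x).imJ) ^ 2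
      + ((b x).imK + (c x).imK) ^ 2) with hpdef
    have hD' : 4 * (d t).re < 0 := by simpa [D₀, hat] using hDle
    have hpt : p t = 0 := by
      rw [hpdef]
      refine Real.sqrt_eq_zero_of_nonpos ?_
      have := H.disc₀ t ht
      rw [hat] at this
      linarith
    refine ⟨fun x => max 0 (-(d x).re - R * p x), ?_, ?_, fun x hx => ⟨le_max_left _ _,
      fun y hy => max_le (H.inward₀_nonneg hx y) ?_⟩⟩
    · exact continuousOn_const.sup (hd.neg.sub (continuousOn_const.mul hp.sqrt))
    · refine lt_max_of_lt_right ?_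
      rw [hpt]
      linarith
    · have hR : 0 ≤ R := (norm_nonneg y).trans hy
      have hp0 : 0 ≤ p x := Real.sqrt_nonneg _
      have hp2 : p x ^ 2 = ((b x).imI + (c x).imI) ^ 2 + ((b x).imJ + (c x).imJ) ^ 2
          + ((b x).imK + (c x).imK) ^ 2 := Real.sq_sqrt (by positivity)
      have hy2 : y.imI ^ 2 + y.imJ ^ 2 + y.imK ^ 2 ≤ R ^ 2 := by
        have : ‖y‖ ^ 2 ≤ R ^ 2 := by gcongr
        rw [norm_sq_eq_components] at this
        linarith [sq_nonneg y.re]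
      have hcs : ((b x).imI + (c x).imI) * y.imI + ((b x).imJ + (c x).imJ) * y.imJ
          + ((b x).imK + (c x).imK) * y.imK ≥ -(R * p x) := by
        refine (abs_le.1 (abs_le_of_sq_le_sq ?_ (by positivity))).1
        rw [mul_pow, hp2]
        refine le_trans ?_ (mul_le_mul_of_nonneg_right hy2 (by positivity))
        linarith [sq_nonneg (((b x).imI + (c x).imI) * y.imJ - ((b x).imJ + (c x).imJ) * y.imI),
          sq_nonneg (((b x).imI + (c x).imI) * y.imK - ((b x).imK + (c x).imK) * y.imI),
          sq_nonneg (((b x).imJ + (c x).imJ) * y.imK - ((b x).imK + (c x).imK) * y.imJ)]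
      have := mul_nonneg (H.a_re x hx)
        (by positivity : 0 ≤ y.imI ^ 2 + y.imJ ^ 2 + y.imK ^ 2)
      unfold inward₀
      linarith
  -- Here 4a₀·inward₀ ≥ -disc together with inward₀ ≥ 0 gives 4(a₀ + 1)·inward₀ ≥ -disc; the shifted
  -- denominator never vanishes.
  · have hpos : ∀ x, 0 ≤ x → 0 < 4 * ((a x).re + 1) := fun x hx => by linarith [H.a_re x hx]
    refine ⟨fun x => -(((b x).imI + (c x).imI) ^ 2 + ((b x).imJ + (c x).imJ) ^ 2
      + ((b x).imK + (c x).imK) ^ 2 + 4 * (a x).re * (d x).re) / (4 * ((a x).re + 1)), ?_, ?_,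
      fun x hx => ⟨div_nonneg (neg_nonneg.2 (H.disc₀ x hx)) (hpos x hx).le, fun y _ => ?_⟩⟩
    · exact (hp.add ((continuousOn_const.mul ha).mul hd)).neg.div
        (continuousOn_const.mul (ha.add continuousOn_const)) fun x hx => (hpos x hx).ne'
    · refine div_pos (neg_pos.2 ?_) (hpos t ht)
      simpa [D₀, hat] using hDle
    · rw [div_le_iff₀ (hpos x hx)]
      have h1 := (quadratic_nonneg_of_discrim_nonpos (x₁ := y.imI) (x₂ := y.imJ) (x₃ := y.imK)
        (H.a_re x hx) (H.d_re x hx) (H.disc₀ x hx)).1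
      have h2 := H.inward₀_nonneg hx y
      unfold inward₀ at h2 ⊢
      linarith

end Strict

/-! ### Contraction in the half-space distance. -/

/-- The hyperbolic-type distance of the half-space `{q₀ > 0}`. -/
noncomputable def halfSpaceDist (x y : ℍ[ℝ]) : ℝ := ‖x - y‖ ^ 2 / (x.re * y.re)

section Contraction

variable {a b c d q r : ℝ → ℍ[ℝ]} {t T R : ℝ}

/-- In the logarithmic derivative the a₁ and b₀ + c₀ terms of |q - r|² cancel against those of q₀
and r₀. All that remains is nonpositive, and -inward₀(q)/q₀ ≤ -γ/R is kept. -/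
theorem halfSpaceDist_le_mul_exp (H : QuadrantInvariant a b c d) (ht : 0 ≤ t)
    (hq : IsSolutionOn a b c d (Icc 0 t) q) (hr : IsSolutionOn a b c d (Icc 0 t) r)
    (hq0 : 0 < (q 0).re) (hr0 : 0 < (r 0).re) (hR : 0 < R)
    (hqR : ∀ x ∈ Icc 0 t, ‖q x‖ ≤ R) (hrR : ∀ x ∈ Icc 0 t, ‖r x‖ ≤ R) {γ : ℝ → ℝ}
    (hγc : ContinuousOn γ (Ici 0)) (hγ : ∀ x, 0 ≤ x → 0 ≤ γ x ∧
      ∀ y : ℍ[ℝ], ‖y‖ ≤ R → γ x ≤ inward₀ (a x) (b x) (c x) (d x) y) :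
    halfSpaceDist (q t) (r t)
      ≤ halfSpaceDist (q 0) (r 0) * Real.exp (-∫ x in (0 : ℝ)..t, γ x / R) := by
  have hqpos : ∀ x ∈ Icc 0 t, 0 < (q x).re := fun x hx =>
    H.re_pos le_rfl hx.1 (hq.mono (Icc_subset_Icc_right hx.2)) hq0
  have hrpos : ∀ x ∈ Icc 0 t, 0 < (r x).re := fun x hx =>
    H.re_pos le_rfl hx.1 (hr.mono (Icc_subset_Icc_right hx.2)) hr0
  rw [← intervalIntegral.integral_neg]
  refine le_mul_exp_integral_of_deriv_le (f := fun x => halfSpaceDist (q x) (r x))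
    (h := fun x => -(γ x / R)) ht
    ((hγc.mono Icc_subset_Ici_self).div_const R).neg
    (fun x hx => (hq.hasDerivWithinAt_norm_sub_sq hr hx).div
      ((hasDerivWithinAt_re (hq x hx)).mul (hasDerivWithinAt_re (hr x hx)))
      (mul_pos (hqpos x hx) (hrpos x hx)).ne') fun x hx => ?_
  have h1 := hqpos x hx
  have h2 := hrpos x hx
  rw [rhs_re (H.a_imJ x hx.1) (H.a_imK x hx.1), rhs_re (H.a_imJ x hx.1) (H.a_imK x hx.1)]
  have e : ∀ y : ℍ[ℝ], (a x * y).re = (a x).re * y.re - (a x).imI * y.imI := fun y => by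
    simp [H.a_imJ x hx.1, H.a_imK x hx.1]
  rw [e, e]
  obtain ⟨g0, g⟩ := hγ x hx.1
  have gq := g _ (hqR x hx)
  have gr := g _ (hrR x hx)
  have hqle := (abs_le.1 ((abs_re_le_norm _).trans (hqR x hx))).2
  have hrle := (abs_le.1 ((abs_re_le_norm _).trans (hrR x hx))).2
  have ha := H.a_re x hx.1
  have hqR' : γ x / R * (q x).re ≤ inward₀ (a x) (b x) (c x) (d x) (q x) := by
    refine le_trans ?_ gq
    rw [div_mul_eq_mul_div, div_le_iff₀ hR]
    gcongr
  have hprod := mul_le_mul_of_nonneg_right hqR' h2.le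
  have hrest : 0 ≤ (q x).re * inward₀ (a x) (b x) (c x) (d x) (r x) :=
    mul_nonneg h1.le (g0.trans gr)
  have hquad : 0 ≤ (a x).re * ((q x).re + (r x).re) * ((q x).re * (r x).re) := by positivity
  unfold halfSpaceDist
  rw [← mul_div_assoc, div_le_div_iff₀ (by positivity) (by positivity)]
  generalize hA : inward₀ (a x) (b x) (c x) (d x) (q x) = A at *
  generalize hB : inward₀ (a x) (b x) (c x) (d x) (r x) = B at *
  have hN : 0 ≤ ‖q x - r x‖ ^ 2 * ((q x).re * (r x).re) := by positivity
  have := mul_nonneg hN (by linarith : 0 ≤ (A * (r x).re - γ x / R * (q x).re * (r x).re)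
    + (q x).re * B + (a x).re * ((q x).re + (r x).re) * ((q x).re * (r x).re))
  linear_combination this

theorem exists_exp_decay_of_re_pos (H : QuadrantInvariant a b c d) (P : PeriodicCoeffs T a b c d)
    (hD : ∃ t, 0 ≤ t ∧ D₀ a b c d t ≠ 0)
    (hq : IsSolutionOn a b c d (Ici 0) q) (hr : IsSolutionOn a b c d (Ici 0) r)
    (hq0 : 0 < (q 0).re) (hr0 : 0 < (r 0).re) (hR : 0 < R)
    (hqR : ∀ x, 0 ≤ x → ‖q x‖ ≤ R) (hrR : ∀ x, 0 ≤ x → ‖r x‖ ≤ R) :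
    ∃ C κ : ℝ, 0 < κ ∧ ∀ t, 0 ≤ t → ‖q t - r t‖ ≤ C * Real.exp (-κ * t) := by
  have hT := P.pos
  obtain ⟨w, hw, hDw⟩ := hD
  obtain ⟨k, u, hu, huT, rfl⟩ := exists_eq_add_nat_mul hT hw
  have hDu : D₀ a b c d u ≠ 0 := by
    unfold D₀ at hDw ⊢
    rwa [P.a.nat_mul hT k hu, P.b.nat_mul hT k hu, P.c.nat_mul hT k hu,
      P.d.nat_mul hT k hu] at hDw
  obtain ⟨γ, hγc, hγu, hγ⟩ := H.exists_le_inward₀ R hu hDu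
  have hg : ∀ t, 0 ≤ t → 0 ≤ ∫ x in (0 : ℝ)..t, γ x / R := fun t ht =>
    intervalIntegral.integral_nonneg ht fun x hx => div_nonneg (hγ x hx.1).1 hR.le
  set g := ∫ x in (0 : ℝ)..T, γ x / R with hgdef
  have hgpos : 0 < g := intervalIntegral.integral_pos hT
    ((hγc.mono Icc_subset_Ici_self).div_const R)
    (fun x hx => div_nonneg (hγ x hx.1.le).1 hR.le) ⟨u, ⟨hu, huT.le⟩, div_pos hγu hR⟩
  have hqpos : ∀ x, 0 ≤ x → 0 < (q x).re := fun x hx =>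
    H.re_pos le_rfl hx (hq.mono Icc_subset_Ici_self) hq0
  have hrpos : ∀ x, 0 ≤ x → 0 < (r x).re := fun x hx =>
    H.re_pos le_rfl hx (hr.mono Icc_subset_Ici_self) hr0
  have hstep : ∀ (n : ℕ) (s : ℝ), 0 ≤ s →
      halfSpaceDist (q (s + n * T)) (r (s + n * T))
        ≤ halfSpaceDist (q (n * T)) (r (n * T)) * Real.exp (-∫ x in (0 : ℝ)..s, γ x / R) := by
    intro n s hs
    have hnT : 0 ≤ n * T := by positivity
    have := halfSpaceDist_le_mul_exp H hs ((hq.shift P n).mono Icc_subset_Ici_self)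
      ((hr.shift P n).mono Icc_subset_Ici_self) (hqpos _ (by simpa using hnT))
      (hrpos _ (by simpa using hnT)) hR (fun x hx => hqR _ (add_nonneg hx.1 hnT))
      (fun x hx => hrR _ (add_nonneg hx.1 hnT)) hγc hγ
    simpa only [zero_add] using this
  have hJ0 : 0 ≤ halfSpaceDist (q 0) (r 0) :=
    div_nonneg (sq_nonneg _) (mul_pos hq0 hr0).le
  have hpow : ∀ n : ℕ, halfSpaceDist (q (n * T)) (r (n * T))
      ≤ halfSpaceDist (q 0) (r 0) * Real.exp (-(n * g)) := by
    intro n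
    induction n with
    | zero => simp
    | succ n ih =>
      have h1 := hstep n T hT.le
      rw [show ((n + 1 : ℕ) : ℝ) * T = T + n * T by push_cast; ring]
      refine h1.trans ((mul_le_mul_of_nonneg_right ih (Real.exp_pos _).le).trans_eq ?_)
      rw [mul_assoc, ← Real.exp_add, ← hgdef]
      push_cast
      ring_nf
  -- The distance controls |q - r|²/R², whence the square root and the halved rate; the factor exp g
  -- pays for the incomplete last period.
  refine ⟨R * √(halfSpaceDist (q 0) (r 0) * Real.exp g), g / (2 * T), by positivity,
    fun t ht => ?_⟩
  obtain ⟨n, s, hs, hsT, rfl⟩ := exists_eq_add_nat_mul hT ht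
  have h1 : halfSpaceDist (q (s + n * T)) (r (s + n * T))
      ≤ halfSpaceDist (q 0) (r 0) * Real.exp g * Real.exp (-(g / T) * (s + n * T)) := by
    refine (hstep n s hs).trans ?_
    have h2 : Real.exp (-∫ x in (0 : ℝ)..s, γ x / R) ≤ 1 :=
      Real.exp_le_one_iff.2 (neg_nonpos.2 (hg s hs))
    have h3 : Real.exp (-(n * g)) ≤ Real.exp g * Real.exp (-(g / T) * (s + n * T)) := by
      rw [← Real.exp_add, Real.exp_le_exp]
      have e : g + -(g / T) * (s + n * T) = g * (1 - s / T) - n * g := by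
        field_simp
        ring
      rw [e]
      have : 0 ≤ g * (1 - s / T) :=
        mul_nonneg hgpos.le (sub_nonneg.2 ((div_le_one hT).2 hsT.le))
      linarith
    have h4 : 0 ≤ halfSpaceDist (q (n * T)) (r (n * T)) := by
      have hnT : 0 ≤ n * T := by positivity
      exact div_nonneg (sq_nonneg _) (mul_pos (hqpos _ hnT) (hrpos _ hnT)).le
    calc _ ≤ halfSpaceDist (q (n * T)) (r (n * T)) := mul_le_of_le_one_right h4 h2
      _ ≤ _ := hpow n
      _ ≤ _ := by
        rw [mul_assoc]
        gcongr
  generalize s + n * T = t at *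
  have hq1 := hqpos t ht
  have hr1 := hrpos t ht
  have hqle := (abs_le.1 ((abs_re_le_norm _).trans (hqR t ht))).2
  have hrle := (abs_le.1 ((abs_re_le_norm _).trans (hrR t ht))).2
  refine (sq_le_sq₀ (norm_nonneg _) (by positivity)).1 ?_
  rw [mul_pow, mul_pow, Real.sq_sqrt (by positivity), ← Real.exp_nat_mul]
  have h5 : ‖q t - r t‖ ^ 2 ≤ halfSpaceDist (q t) (r t) * R ^ 2 := by
    have h6 : ‖q t - r t‖ ^ 2 = halfSpaceDist (q t) (r t) * ((q t).re * (r t).re) := by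
      unfold halfSpaceDist
      field_simp
    rw [h6, sq R]
    have : 0 ≤ halfSpaceDist (q t) (r t) := div_nonneg (sq_nonneg _) (mul_pos hq1 hr1).le
    gcongr
  have h7 : ((2 : ℕ) : ℝ) * (-(g / (2 * T)) * t) = -(g / T) * t := by
    push_cast
    field_simp
  rw [h7]
  calc _ ≤ _ := h5
    _ ≤ _ := mul_le_mul_of_nonneg_right h1 (sq_nonneg R)
    _ = _ := by ring

end Contraction

/-! ### Convergence, the periodic solution and the discriminant conditions. -/

section Main

variable {a b c d q r : ℝ → ℍ[ℝ]} {T : ℝ}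

theorem exists_nat_mul_gt (hT : 0 < T) (s : ℝ) : ∃ n : ℕ, s < n * T := by
  obtain ⟨n, hn⟩ := exists_nat_gt (s / T)
  exact ⟨n, (div_lt_iff₀ hT).1 hn⟩

/-- Any two solutions that start in `{q₀ ≥ 0, q₁ ≥ 0}` approach each other exponentially fast. -/
theorem exists_exp_decay (H : QuadrantInvariant a b c d) (P : PeriodicCoeffs T a b c d)
    (ha : ∃ t, 0 ≤ t ∧ (a t).re + (a t).imI ≠ 0) (hD : ∃ t, 0 ≤ t ∧ D₀ a b c d t ≠ 0)
    (hq : IsSolutionOn a b c d (Ici 0) q) (hr : IsSolutionOn a b c d (Ici 0) r)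
    (hq0 : NonnegComponents (q 0)) (hr0 : NonnegComponents (r 0)) :
    ∃ C κ : ℝ, 0 < κ ∧ ∀ t, 0 ≤ t → ‖q t - r t‖ ≤ C * Real.exp (-κ * t) := by
  obtain ⟨s, hs, hDs⟩ := hD
  obtain ⟨n, hn⟩ := exists_nat_mul_gt P.pos s
  obtain ⟨R₁, hR₁⟩ := H.exists_norm_le P ha hq hq0
  obtain ⟨R₂, hR₂⟩ := H.exists_norm_le P ha hr hr0
  have hnT : 0 ≤ n * T := hs.trans hn.le
  have hR₁0 : 0 ≤ R₁ := (norm_nonneg _).trans (hR₁ 0 le_rfl)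
  have hR₂0 : 0 ≤ R₂ := (norm_nonneg _).trans (hR₂ 0 le_rfl)
  -- Translating by n whole periods past s keeps the equation and makes both real parts positive at
  -- the new initial time.
  obtain ⟨C, κ, hκ, hC⟩ := exists_exp_decay_of_re_pos (R := R₁ + R₂ + 1) H P ⟨s, hs, hDs⟩
    (hq.shift P n) (hr.shift P n)
    (by simpa only [zero_add] using H.re_pos_of_D₀ hs hn hDs hq hq0.1)
    (by simpa only [zero_add] using H.re_pos_of_D₀ hs hn hDs hr hr0.1) (by linarith)
    (fun x hx => (hR₁ _ (add_nonneg hx hnT)).trans (by linarith))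
    (fun x hx => (hR₂ _ (add_nonneg hx hnT)).trans (by linarith))
  have hC0 : 0 ≤ C := by
    have := (norm_nonneg _).trans (hC 0 le_rfl)
    simpa using this
  refine ⟨(C + R₁ + R₂) * Real.exp (κ * (n * T)), κ, hκ, fun t ht => ?_⟩
  rw [mul_assoc, ← Real.exp_add]
  rcases le_total (n * T) t with h | h
  · have h1 := hC (t - n * T) (sub_nonneg.2 h)
    rw [sub_add_cancel] at h1
    rw [show κ * (n * T) + -κ * t = -κ * (t - n * T) by ring]
    exact h1.trans (mul_le_mul_of_nonneg_right (by linarith) (Real.exp_pos _).le)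
  · have h1 : 1 ≤ Real.exp (κ * (n * T) + -κ * t) := by
      rw [Real.one_le_exp_iff]
      nlinarith
    calc ‖q t - r t‖ ≤ ‖q t‖ + ‖r t‖ := norm_sub_le _ _
      _ ≤ C + R₁ + R₂ := by linarith [hR₁ t ht, hR₂ t ht]
      _ ≤ _ := le_mul_of_one_le_right (by positivity) h1

/-- The solution from 0 and its T-translate converge geometrically along multiples of T, so its
values there are Cauchy. The limit is a fixed point of the period map by continuous dependence, and
uniqueness turns this into periodicity. -/
theorem exists_periodic_solution (H : QuadrantInvariant a b c d) (P : PeriodicCoeffs T a b c d)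
    (ha : ∃ t, 0 ≤ t ∧ (a t).re + (a t).imI ≠ 0) (hD : ∃ t, 0 ≤ t ∧ D₀ a b c d t ≠ 0) :
    ∃ q, IsSolutionOn a b c d (Ici 0) q ∧ PeriodicOnHalfLine T q ∧ NonnegComponents (q 0) := by
  obtain ⟨M, hM⟩ := P.exists_coeffBound H
  have hT := P.pos
  obtain ⟨q, hq, hq0⟩ := H.exists_solution hM (x := 0) ⟨by simp, by simp⟩
  have hqn : ∀ t, 0 ≤ t → NonnegComponents (q t) := fun t ht =>
    H.nonnegComponents le_rfl ht (hq.mono Icc_subset_Ici_self) (by rw [hq0]; simp [NonnegComponents])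
  obtain ⟨C, κ, hκ, hC⟩ := exists_exp_decay H P ha hD hq (hq.shift P 1) (hqn 0 le_rfl)
    (hqn _ (by simpa using hT.le))
  have hcau : CauchySeq fun n : ℕ => q (n * T) := by
    refine cauchySeq_of_le_geometric (Real.exp (-κ * T)) C
      (Real.exp_lt_one_iff.2 (by nlinarith)) fun n => ?_
    rw [dist_eq_norm, ← Real.exp_nat_mul]
    have := hC (n * T) (by positivity)
    rwa [show -κ * (n * T) = n * (-κ * T) by ring,
      show (n : ℝ) * T + (1 : ℕ) * T = ((n + 1 : ℕ) : ℝ) * T by push_cast; ring] at this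
  obtain ⟨x, hx⟩ := cauchySeq_tendsto_of_complete hcau
  have hxn : NonnegComponents x :=
    ⟨ge_of_tendsto' ((Quaternion.continuous_re.tendsto x).comp hx) fun n =>
        (hqn (n * T) (by positivity)).1,
      ge_of_tendsto' ((Quaternion.continuous_imI.neg.tendsto x).comp hx) fun n =>
        (hqn (n * T) (by positivity)).2⟩
  obtain ⟨p, hp, hp0⟩ := H.exists_solution hM hxn
  have hpT : p T = p 0 := by
    have h1 : Tendsto (fun n : ℕ => q (T + n * T)) atTop (𝓝 x) := by
      refine (hx.comp (tendsto_add_atTop_nat 1)).congr fun n => ?_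
      simp only [Function.comp]
      congr 1
      push_cast
      ring
    have h2 : Tendsto (fun n : ℕ => q (T + n * T)) atTop (𝓝 (p T)) := by
      rw [tendsto_iff_norm_sub_tendsto_zero] at hx ⊢
      refine squeeze_zero (fun _ => norm_nonneg _) (fun n => ?_)
        (by simpa using hx.mul_const (Real.exp (2 * M * T)))
      have hnT : 0 ≤ n * T := by positivity
      have := H.norm_sub_le le_rfl hT.le ((hq.shift P n).mono Icc_subset_Ici_self)
        (hp.mono Icc_subset_Ici_self) (hqn _ (by simpa using hnT)) (by rwa [hp0])
        (B := 2 * M) fun y hy => by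
          obtain ⟨-, hb, hc, -⟩ := hM y hy.1
          have := (abs_le.1 ((abs_re_le_norm _).trans hb)).1
          have := (abs_le.1 ((abs_re_le_norm _).trans hc)).1
          linarith
      simpa only [zero_add, hp0, sub_zero] using this
    rw [hp0]
    exact tendsto_nhds_unique h2 h1
  refine ⟨p, hp, fun t ht => ?_, by rwa [hp0]⟩
  have hs := hp.shift P 1
  simp only [Nat.cast_one, one_mul] at hs
  exact H.eq_of_eq le_rfl ht (hs.mono Icc_subset_Ici_self) (hp.mono Icc_subset_Ici_self)
    (by simpa using hpT)

theorem boundedOnHalfLine_diffIntegral {M C κ : ℝ} (haM : ∀ t, 0 ≤ t → ‖a t‖ ≤ M) (hκ : 0 < κ)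
    (hC : ∀ t, 0 ≤ t → ‖q t - r t‖ ≤ C * Real.exp (-κ * t)) :
    BoundedOnHalfLine (diffIntegral a q r) := by
  have hM0 : 0 ≤ M := (norm_nonneg _).trans (haM 0 le_rfl)
  have hC0 : 0 ≤ C := by
    have := (norm_nonneg _).trans (hC 0 le_rfl)
    simpa using this
  refine ⟨M * C / κ, fun t ht => ?_⟩
  have hle := intervalIntegral.norm_integral_le_of_norm_le (μ := MeasureTheory.volume) ht
    (f := fun τ => (a τ * (q τ - r τ)).re) (g := fun τ => M * C * Real.exp (-κ * τ))
    (Eventually.of_forall fun τ hτ => by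
      refine (abs_re_le_norm _).trans ?_
      rw [norm_mul, mul_assoc]
      exact mul_le_mul (haM τ hτ.1.le) (hC τ hτ.1.le) (norm_nonneg _) hM0)
    (Continuous.intervalIntegrable (by fun_prop) _ _)
  refine hle.trans ?_
  have hder : ∀ x ∈ uIcc 0 t, HasDerivAt (fun τ => -(M * C / κ) * Real.exp (-κ * τ))
      (M * C * Real.exp (-κ * x)) x := fun x _ => by
    refine (((hasDerivAt_id x).const_mul (-κ)).exp.const_mul (-(M * C / κ))).congr_deriv ?_
    simp only [id]
    field_simp
  rw [intervalIntegral.integral_eq_sub_of_hasDerivAt hder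
    (Continuous.intervalIntegrable (by fun_prop) _ _)]
  simp only [mul_zero, Real.exp_zero, mul_one]
  have : 0 ≤ M * C / κ * Real.exp (-κ * t) := by positivity
  linarith

/-- The discriminant is continuous, so its sign passes from {α ≠ 0} to the closure. A zero of α is
either in that closure, by the support conditions, or all pᵢ vanish there and the expression is 0.
-/
theorem discrim_nonpos_of_supp_subset {α δ p₁ p₂ p₃ : ℝ → ℝ} (hα : ContinuousOn α (Ici 0))
    (hδ : ContinuousOn δ (Ici 0)) (hp₁ : ContinuousOn p₁ (Ici 0))
    (hp₂ : ContinuousOn p₂ (Ici 0)) (hp₃ : ContinuousOn p₃ (Ici 0))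
    (h₁ : supp p₁ ⊆ supp α) (h₂ : supp p₂ ⊆ supp α) (h₃ : supp p₃ ⊆ supp α)
    (h : ∀ t, 0 ≤ t → α t ≠ 0 → p₁ t ^ 2 + p₂ t ^ 2 + p₃ t ^ 2 + 4 * α t * δ t ≤ 0)
    {t : ℝ} (ht : 0 ≤ t) : p₁ t ^ 2 + p₂ t ^ 2 + p₃ t ^ 2 + 4 * α t * δ t ≤ 0 := by
  set S : Set ℝ := Ici 0 ∩
    (fun t => p₁ t ^ 2 + p₂ t ^ 2 + p₃ t ^ 2 + 4 * α t * δ t) ⁻¹' Iic 0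
  have hcl : IsClosed S := ContinuousOn.preimage_isClosed_of_isClosed
    ((((hp₁.pow 2).add (hp₂.pow 2)).add (hp₃.pow 2)).add ((continuousOn_const.mul hα).mul hδ))
    isClosed_Ici isClosed_Iic
  have hsub : supp α ⊆ S := closure_minimal (fun x hx => ⟨hx.1, h x hx.1 hx.2⟩) hcl
  have hmem : ∀ {p : ℝ → ℝ}, supp p ⊆ supp α → p t ≠ 0 →
      p₁ t ^ 2 + p₂ t ^ 2 + p₃ t ^ 2 + 4 * α t * δ t ≤ 0 := fun hp hpt =>
    (hsub (hp (subset_closure ⟨ht, hpt⟩))).2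
  by_cases h0 : α t = 0
  · by_cases e₁ : p₁ t = 0
    · by_cases e₂ : p₂ t = 0
      · by_cases e₃ : p₃ t = 0
        · simp [h0, e₁, e₂, e₃]
        · exact hmem h₃ e₃
      · exact hmem h₂ e₂
    · exact hmem h₁ e₁
  · exact h t ht h0

theorem nonpos_of_discrim_nonpos {α δ p₁ p₂ p₃ : ℝ} (hα : 0 ≤ α)
    (h : (if α ≠ 0 then p₁ ^ 2 + p₂ ^ 2 + p₃ ^ 2 + 4 * α * δ else 4 * δ) ≤ 0) : δ ≤ 0 := by
  split_ifs at h with h0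
  · have hα' : 0 < α := hα.lt_of_ne' h0
    by_contra! hδ
    have : 0 < 4 * α * δ := by positivity
    linarith [sq_nonneg p₁, sq_nonneg p₂, sq_nonneg p₃]
  · linarith

end Main

end QRiccati

theorem theorem3p1 (T : ℝ) (hT : 0 < T) (a b c d : ℝ → ℍ[ℝ])
    (ha : ContinuousOn a (Set.Ici 0)) (hb : ContinuousOn b (Set.Ici 0))
    (hc : ContinuousOn c (Set.Ici 0)) (hd : ContinuousOn d (Set.Ici 0))
    (haT : QRiccati.PeriodicOnHalfLine T a) (hbT : QRiccati.PeriodicOnHalfLine T b)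
    (hcT : QRiccati.PeriodicOnHalfLine T c) (hdT : QRiccati.PeriodicOnHalfLine T d)
    -- condition on `a`
    (ha_nonneg : ∀ t, 0 ≤ t → 0 ≤ (a t).re ∧ 0 ≤ (a t).imI)
    (ha_ne : ∃ t, 0 ≤ t ∧ (a t).re + (a t).imI ≠ 0)
    (ha_zero : ∀ t, 0 ≤ t → (a t).imJ = 0 ∧ (a t).imK = 0)
    -- condition on `D₀` and `D₁`
    (hD_nonpos : ∀ t, 0 ≤ t → QRiccati.D₀ a b c d t ≤ 0 ∧ QRiccati.D₁ a b c d t ≤ 0)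
    (hD₀_ne : ∃ t, 0 ≤ t ∧ QRiccati.D₀ a b c d t ≠ 0)
    (hD₁_ne : ∃ t, 0 ≤ t ∧ QRiccati.D₁ a b c d t ≠ 0)
    -- support conditions: `p_{n,m}` is supported in the support of `a_n`
    (hs01 : QRiccati.supp (fun t => (b t).imI + (c t).imI) ⊆ QRiccati.supp (fun t => (a t).re))
    (hs02 : QRiccati.supp (fun t => (b t).imJ + (c t).imJ) ⊆ QRiccati.supp (fun t => (a t).re))
    (hs03 : QRiccati.supp (fun t => (b t).imK + (c t).imK) ⊆ QRiccati.supp (fun t => (a t).re))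
    (hs11 : QRiccati.supp (fun t => (b t).imI + (c t).imI) ⊆ QRiccati.supp (fun t => (a t).imI))
    (hs12 : QRiccati.supp (fun t => (b t).imJ - (c t).imJ) ⊆ QRiccati.supp (fun t => (a t).imI))
    (hs13 : QRiccati.supp (fun t => (b t).imK - (c t).imK) ⊆ QRiccati.supp (fun t => (a t).imI))
    -- boundedness conditions
    (hq02 : QRiccati.BoundedOnHalfLine
      (QRiccati.quot₀ (fun t => (b t).imJ + (c t).imJ) (fun t => (a t).re)))
    (hq03 : QRiccati.BoundedOnHalfLine
      (QRiccati.quot₀ (fun t => (b t).imK + (c t).imK) (fun t => (a t).re)))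
    (hq12 : QRiccati.BoundedOnHalfLine
      (QRiccati.quot₀ (fun t => (b t).imJ - (c t).imJ) (fun t => (a t).imI)))
    (hq13 : QRiccati.BoundedOnHalfLine
      (QRiccati.quot₀ (fun t => (b t).imK - (c t).imK) (fun t => (a t).imI)))
    -- mean value condition
    (hint : 0 ≤ ∫ τ in (0 : ℝ)..T, ((b τ).re + (c τ).re)) :
    ∃ m₀ : ℕ, 0 < m₀ ∧ ∃ q : ℝ → ℍ[ℝ],
      QRiccati.IsSolutionOn a b c d (Set.Ici 0) q ∧
      QRiccati.PeriodicOnHalfLine (m₀ * T) q ∧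
      (∀ t, 0 ≤ t → QRiccati.NonnegComponents (q t)) ∧
      ((∃ t, 0 ≤ t ∧ QRiccati.D₀ a b c d t * QRiccati.D₁ a b c d t ≠ 0) →
        QRiccati.IsNormal a b c d 0 q ∧
        -- every solution `r` starting at time `0` with nonnegative components `0` and `1`
        -- continues to `[0, ∞)`, and the continued solution has the asserted properties
        ∀ τ : ℝ, 0 < τ → ∀ r : ℝ → ℍ[ℝ],
          QRiccati.IsSolutionOn a b c d (Set.Ico 0 τ) r → QRiccati.NonnegComponents (r 0) →
            ∃ s : ℝ → ℍ[ℝ], QRiccati.IsSolutionOn a b c d (Set.Ici 0) s ∧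
              Set.EqOn s r (Set.Ico 0 τ) ∧
              QRiccati.IsNormal a b c d 0 s ∧
              QRiccati.BoundedOnHalfLine (QRiccati.diffIntegral a q s)) := by
  -- Taking δ = -d₁ gives `D₁` the shape of `D₀`, so the same lemmas serve both.
  have hd₁ : ∀ t, 0 ≤ t →
      (if (a t).imI ≠ 0 then ((b t).imI + (c t).imI) ^ 2 + ((b t).imJ - (c t).imJ) ^ 2
        + ((b t).imK - (c t).imK) ^ 2 + 4 * (a t).imI * -(d t).imI else 4 * -(d t).imI) ≤ 0 := by
    intro t ht
    have := (hD_nonpos t ht).2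
    unfold QRiccati.D₁ at this
    convert this using 2 <;> ring
  have H : QRiccati.QuadrantInvariant a b c d :=
    { cont_a := ha
      cont_b := hb
      cont_c := hc
      cont_d := hd
      a_re := fun t ht => (ha_nonneg t ht).1
      a_imI := fun t ht => (ha_nonneg t ht).2
      a_imJ := fun t ht => (ha_zero t ht).1
      a_imK := fun t ht => (ha_zero t ht).2
      d_re := fun t ht =>
        QRiccati.nonpos_of_discrim_nonpos (ha_nonneg t ht).1 (hD_nonpos t ht).1
      d_imI := fun t ht =>
        neg_nonpos.1 (QRiccati.nonpos_of_discrim_nonpos (ha_nonneg t ht).2 (hd₁ t ht))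
      disc₀ := fun t ht => QRiccati.discrim_nonpos_of_supp_subset
        (QRiccati.continuousOn_re ha) (QRiccati.continuousOn_re hd)
        ((QRiccati.continuousOn_imI hb).add (QRiccati.continuousOn_imI hc))
        ((QRiccati.continuousOn_imJ hb).add (QRiccati.continuousOn_imJ hc))
        ((QRiccati.continuousOn_imK hb).add (QRiccati.continuousOn_imK hc)) hs01 hs02 hs03
        (fun s hs h0 => by simpa [QRiccati.D₀, h0] using (hD_nonpos s hs).1) ht
      disc₁ := fun t ht => by
        have := QRiccati.discrim_nonpos_of_supp_subset
          (QRiccati.continuousOn_imI ha) (QRiccati.continuousOn_imI hd).neg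
          ((QRiccati.continuousOn_imI hb).add (QRiccati.continuousOn_imI hc))
          ((QRiccati.continuousOn_imJ hb).sub (QRiccati.continuousOn_imJ hc))
          ((QRiccati.continuousOn_imK hb).sub (QRiccati.continuousOn_imK hc)) hs11 hs12 hs13
          (fun s hs h0 => by
            have := hd₁ s hs
            rwa [if_pos h0] at this) ht
        simp only [Pi.add_apply, Pi.sub_apply, Pi.neg_apply] at this
        linarith }
  have P : QRiccati.PeriodicCoeffs T a b c d := ⟨hT, haT, hbT, hcT, hdT⟩
  obtain ⟨M, hM⟩ := P.exists_coeffBound H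
  obtain ⟨q, hq, hqT, hq0⟩ := QRiccati.exists_periodic_solution H P ha_ne hD₀_ne
  refine ⟨1, one_pos, q, hq, by rwa [Nat.cast_one, one_mul], fun t ht =>
    H.nonnegComponents le_rfl ht (hq.mono Set.Icc_subset_Ici_self) hq0, ?_⟩
  rintro ⟨t, ht, hDt⟩
  have hnormal : ∀ s, QRiccati.IsSolutionOn a b c d (Set.Ici 0) s →
      QRiccati.NonnegComponents (s 0) → QRiccati.IsNormal a b c d 0 s := fun s hs hs0 =>
    -- Any time after t would do: the factors D₀ and D₁ are both nonzero at t, so q₀ and q₁ are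
    -- positive from then on.
    H.isNormal hM hs hs0 (t₁ := t + 1) (by linarith)
      (H.re_pos_of_D₀ ht (lt_add_one t) (left_ne_zero_of_mul hDt) hs hs0.1)
      (H.neg_imI_pos_of_D₁ ht (lt_add_one t) (right_ne_zero_of_mul hDt) hs hs0.2)
  refine ⟨hnormal q hq hq0, fun τ _ r hr hr0 => ?_⟩
  obtain ⟨s, hs, hs0⟩ := H.exists_solution hM hr0
  have hs0' : QRiccati.NonnegComponents (s 0) := by rwa [hs0]
  obtain ⟨C, κ, hκ, hC⟩ := QRiccati.exists_exp_decay H P ha_ne hD₀_ne hq hs hq0 hs0'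
  exact ⟨s, hs, H.eqOn hs hr hs0, hnormal s hs hs0',
    QRiccati.boundedOnHalfLine_diffIntegral (fun t ht => (hM t ht).1) hκ hC⟩
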